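/- Let $G=(V,E)$ be a finite directed graph (the links of a fixed peering configuration) with $|V|\ge 2$, a source $s\in V$, receivers $R=V\setminus\{s\}$, and upload capacities $C_v\ge 0$, $v\in V$. Nothing is sent to the source: put $out(v)=\{u:(v,u)\in E,\ u\ne s\}$ and $in(v)=\{u: v\in out(u)\}$. Let $U:[0,\infty)\to\mathbb R$ be strictly concave and twice differentiable (one-sidedly at $0$). The broadcast problem is $$\mathbf{MP}:\quad \max_{z,f,g\ge 0} U(z)\quad\text{s.t.}\quad \sum_{u\in in(v)} f^d_{uv}+z\mathbb 1_{\{v=s\}}\le\sum_{u\in out(v)}f^d_{vu}\ \ (d\in R,\ v\in V\setminus\{d\}),$$ $$f^d_{vu}\le g_{vu}\ \ (v\in V,\ u\in out(v),\ d\in R),\qquad \sum_{u\in out(v)}g_{vu}\le C_v\ \ (v\in V),$$ with $f,g$ indexed by the links $(v,u)$, $u\in out(v)$. Its partial Lagrangian is $L(z,f,\lambda)=U(z)-\sum_{v\in V}\sum_{d\in R}\lambda_{v,d}\big(\sum_{u\in in(v)}f^d_{uv}+z\mathbb 1_{\{v=s\}}-\sum_{u\in out(v)}f^d_{vu}\big)$,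 with multipliers in $\Lambda=\{\lambda\ge 0:\lambda_{d,d}=0\ \forall d\in R\}$. Back-pressure scheduling. Given $\lambda$, let $w_{vu}=\sum_{d\in R}[\lambda_{v,d}-\lambda_{u,d}]^+$. Every node $v$ with $out(v)\neq\emptyset$ picks $u^*(v)\in\arg\max_{u\in out(v)}w_{vu}$ (ties broken arbitrarily), sets $g_{vu}=C_v$ if $u=u^*(v)$ and $g_{vu}=0$ otherwise, and sets $f^d_{vu}=g_{vu}$ if $\lambda_{v,d}>\lambda_{u,d}$ and $f^d_{vu}=0$ otherwise. Let $D(\lambda)$ be the set of all decisions $(f,g)$ arising in this way and $K(\lambda)=\bigcap_{\varepsilon>0}\overline{\mathrm{conv}}\bigcup\{D(\mu):\mu\in\Lambda,\ \|\mu-\lambda\|<\varepsilon\}$ its Krasovskii–Filippov convexification, so that $D(\lambda)\subseteq K(\lambda)$ for $\lambda\in\Lambda$. Rate control. With constants $\alpha>0$, $k_{v,d}>0$, and $[b]^+_a=\max(0,b)$ if $a\le 0$, $[b]^+_a=b$ if $a>0$, a trajectory of the algorithm is a tuple $(z,\lambda,f,g)$ on $[0,\infty)$ with $z,\lambda$ locally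 absolutely continuous, $f,g$ measurable, arbitrary initial values $z(0)\ge 0$, $\lambda(0)\ge 0$, and, for almost every $t>0$, $(f(t),g(t))\in K(\lambda(t))$ and $$\dot z=\alpha\Big[U'(z)-\sum_{d\in R}\lambda_{s,d}\Big]^+_z,\qquad \dot\lambda_{v,d}=k_{v,d}\Big[\sum_{u\in in(v)}f^d_{uv}+z\mathbb 1_{\{v=s\}}-\sum_{u\in out(v)}f^d_{vu}\Big]^+_{\lambda_{v,d}}\ (v\ne d),\qquad \lambda_{d,d}\equiv 0 .$$ Theorem. The problem $\mathbf{MP}$ has an optimal solution, and all its optimal solutions have the same rate $z^*$. Every trajectory of the algorithm, from every initial state, satisfies, as $t\to\infty$: (i) $z(t)\to z^*$; (ii) $\lambda(t)$ converges to some $\lambda^*\in\Lambda$ such that, for every optimal solution $(z^*,f^*,g^*)$ of $\mathbf{MP}$, $(z^*,f^*,g^*;\lambda^*)$ is a saddle point of $L$: a maximum over $z\ge0$ and $f,g\geq 0$ subject to the last two constraints of $\mathbf{MP}$, and a minimum over $\Lambda$; (iii) the distance of $\big(z(t),\ \tfrac1t\int_0^t f(\tau)\,d\tau,\ \tfrac1t\int_0^t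 g(\tau)\,d\tau\big)$ to the set of optimal solutions of $\mathbf{MP}$ tends to $0$. -/

import Mathlib

open Filter Topology MeasureTheory

/-- An overlay network under a fixed peering configuration: a directed graph of links, a
streaming source, and a nonnegative upload capacity at every node. -/
structure OverlayNetwork (V : Type*) where
  graph : Digraph V
  source : V
  capacity : V → ℝ
  capacity_nonneg : ∀ v, 0 ≤ capacity v

namespace OverlayNetwork

/-- The receivers: all nodes other than the source. -/
abbrev Receiver {V : Type*} (N : OverlayNetwork V) : Type _ := {d : V // d ≠ N.source}

noncomputable instance {V : Type*} [Fintype V] (N : OverlayNetwork V) : Fintype N.Receiver :=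
  Fintype.ofFinite _

/-- The links that may carry content.  Nothing is ever sent to the source. -/
def Link {V : Type*} (N : OverlayNetwork V) (v u : V) : Prop := N.graph.Adj v u ∧ u ≠ N.source

open Classical in
/-- `out(v)`, the nodes receiving content from `v`. -/
noncomputable def outNbrs {V : Type*} [Fintype V] (N : OverlayNetwork V) (v : V) : Finset V :=
  Finset.univ.filter fun u => N.Link v u

open Classical in
/-- `in(v)`, the nodes sending content to `v` (empty for the source). -/
noncomputable def inNbrs {V : Type*} [Fintype V] (N : OverlayNetwork V) (v : V) : Finset V :=
  Finset.univ.filter fun u => N.Link u v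

/-- Information flows: `f d v u` is the rate on the link `(v, u)` of the flow destined to `d`. -/
abbrev Flows {V : Type*} (N : OverlayNetwork V) : Type _ := N.Receiver → V → V → ℝ

/-- Physical rates: `g v u` is the physical rate on the link `(v, u)`. -/
abbrev Rates {V : Type*} (_N : OverlayNetwork V) : Type _ := V → V → ℝ

/-- Multipliers (queue lengths) `lam v d`. -/
abbrev Multipliers {V : Type*} (N : OverlayNetwork V) : Type _ := V → N.Receiver → ℝ

open Classical in
/-- Excess of flow `d` at node `v` when the source injects rate `z`:
`∑_{u ∈ in(v)} f_{uv}^d + z 1_{v = s} - ∑_{u ∈ out(v)} f_{vu}^d`. -/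
noncomputable def excess {V : Type*} [Fintype V] (N : OverlayNetwork V) (z : ℝ) (f : N.Flows)
    (v : V) (d : N.Receiver) : ℝ :=
  (∑ u ∈ N.inNbrs v, f d u v) + (if v = N.source then z else 0) - ∑ u ∈ N.outNbrs v, f d v u

/-- The piggybacking and upload-capacity constraints, together with nonnegativity.  The variables
are indexed by links, i.e. they vanish on pairs of nodes that are not links. -/
structure Schedulable {V : Type*} [Fintype V] (N : OverlayNetwork V) (f : N.Flows) (g : N.Rates) :
    Prop where
  flow_nonneg : ∀ d v u, 0 ≤ f d v u
  rate_nonneg : ∀ v u, 0 ≤ g v u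
  flow_off_link : ∀ d v u, ¬ N.Link v u → f d v u = 0
  rate_off_link : ∀ v u, ¬ N.Link v u → g v u = 0
  piggyback : ∀ d v u, N.Link v u → f d v u ≤ g v u
  upload : ∀ v, ∑ u ∈ N.outNbrs v, g v u ≤ N.capacity v

/-- Feasibility of `(z, f, g)` for the broadcast problem. -/
structure Feasible {V : Type*} [Fintype V] (N : OverlayNetwork V)
    (x : ℝ × N.Flows × N.Rates) : Prop where
  broadcast_nonneg : 0 ≤ x.1
  schedulable : N.Schedulable x.2.1 x.2.2
  conservation : ∀ (d : N.Receiver) (v : V), v ≠ d.1 → N.excess x.1 x.2.1 v d ≤ 0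

/-- The set of optimal solutions `(z, f, g)` of the broadcast problem: maximize `U z` over the
feasible points. -/
def optimalSet {V : Type*} [Fintype V] (N : OverlayNetwork V) (U : ℝ → ℝ) :
    Set (ℝ × N.Flows × N.Rates) :=
  {x | N.Feasible x ∧ ∀ y, N.Feasible y → U y.1 ≤ U x.1}

/-- The admissible multipliers: nonnegative, and zero at the destination. -/
def multiplierSet {V : Type*} (N : OverlayNetwork V) : Set N.Multipliers :=
  {lam | (∀ v d, 0 ≤ lam v d) ∧ ∀ d : N.Receiver, lam d.1 d = 0}

open Classical in
/-- The partial Lagrangian, in which the flow conservation constraints are relaxed. -/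
noncomputable def lagrangian {V : Type*} [Fintype V] (N : OverlayNetwork V) (U : ℝ → ℝ)
    (z : ℝ) (f : N.Flows) (lam : N.Multipliers) : ℝ :=
  U z - ∑ v : V, ∑ d : N.Receiver, lam v d * N.excess z f v d

/-- `(z, f, g; lam)` is a saddle point of the partial Lagrangian: it is a maximum over
`z ≥ 0` and schedulable `(f, g)`, and a minimum over the admissible multipliers. -/
structure IsSaddlePoint {V : Type*} [Fintype V] (N : OverlayNetwork V) (U : ℝ → ℝ)
    (x : ℝ × N.Flows × N.Rates) (lam : N.Multipliers) : Prop where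
  broadcast_nonneg : 0 ≤ x.1
  schedulable : N.Schedulable x.2.1 x.2.2
  mem_multiplierSet : lam ∈ N.multiplierSet
  primal : ∀ y : ℝ × N.Flows × N.Rates, 0 ≤ y.1 → N.Schedulable y.2.1 y.2.2 →
    N.lagrangian U y.1 y.2.1 lam ≤ N.lagrangian U x.1 x.2.1 lam
  dual : ∀ mu ∈ N.multiplierSet, N.lagrangian U x.1 x.2.1 lam ≤ N.lagrangian U x.1 x.2.1 mu

open Classical in
/-- The aggregate back-pressure `w_{vu} = ∑_d [lam_{v,d} - lam_{u,d}]^+`. -/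
noncomputable def backPressure {V : Type*} [Fintype V] (N : OverlayNetwork V)
    (lam : N.Multipliers) (v u : V) : ℝ :=
  ∑ d : N.Receiver, max (lam v d - lam u d) 0

open Classical in
/-- `(f, g)` is a decision of the back-pressure scheduler at `lam`: every node `v` that has an
out-neighbor selects one, `next v`, of maximal back-pressure (ties broken arbitrarily), serves
only that neighbor, at rate `C_v`, and lets exactly the flows with positive queue difference
take part. -/
def IsBackPressureDecision {V : Type*} [Fintype V] (N : OverlayNetwork V) (lam : N.Multipliers)
    (p : N.Flows × N.Rates) : Prop :=
  ∃ next : V → V,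
    (∀ v, (N.outNbrs v).Nonempty → next v ∈ N.outNbrs v ∧
      ∀ u ∈ N.outNbrs v, N.backPressure lam v u ≤ N.backPressure lam v (next v)) ∧
    (∀ v u, p.2 v u = if u ∈ N.outNbrs v ∧ u = next v then N.capacity v else 0) ∧
    (∀ d v u, p.1 d v u = if lam v d - lam u d ≤ 0 then 0 else p.2 v u)

/-- The decisions available to the fluid at `lam`.  The scheduler depends discontinuously on
`lam`, so the differential equation is understood in the sense of Krasovskii-Filippov: the
decisions taken arbitrarily close to `lam` are convexified. In particular every back-pressure
decision at `lam` itself is available. -/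
def fluidDecisions {V : Type*} [Fintype V] (N : OverlayNetwork V) (lam : N.Multipliers) :
    Set (N.Flows × N.Rates) :=
  ⋂ ε > (0 : ℝ), closure (convexHull ℝ
    {p | ∃ mu ∈ N.multiplierSet, dist mu lam < ε ∧ N.IsBackPressureDecision mu p})

open Classical in
/-- The projection `[b]_a^+`. -/
noncomputable def posProj (b a : ℝ) : ℝ := if a ≤ 0 then max 0 b else b

open Classical in
/-- `(z, lam, f, g)` is a trajectory on `[0, ∞)` of the primal-dual back-pressure algorithm with
step sizes `α` and `k`, started from an arbitrary nonnegative state: `z` and `lam` are locally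
absolutely continuous and satisfy the differential equations at almost every time. -/
structure IsTrajectory {V : Type*} [Fintype V] (N : OverlayNetwork V) (U : ℝ → ℝ) (α : ℝ)
    (k : V → N.Receiver → ℝ) (z : ℝ → ℝ) (lam : ℝ → N.Multipliers) (f : ℝ → N.Flows)
    (g : ℝ → N.Rates) : Prop where
  init_broadcast : 0 ≤ z 0
  init_multiplier : ∀ v d, 0 ≤ lam 0 v d
  ac_broadcast : ∀ T > 0, AbsolutelyContinuousOnInterval z 0 T
  ac_multiplier : ∀ v d, ∀ T > 0, AbsolutelyContinuousOnInterval (fun t => lam t v d) 0 T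
  aemeasurable_flow : ∀ d v u,
    AEMeasurable (fun t => f t d v u) (volume.restrict (Set.Ioi 0))
  aemeasurable_rate : ∀ v u,
    AEMeasurable (fun t => g t v u) (volume.restrict (Set.Ioi 0))
  scheduling : ∀ᵐ t ∂(volume.restrict (Set.Ioi (0 : ℝ))), (f t, g t) ∈ N.fluidDecisions (lam t)
  broadcast_ode : ∀ᵐ t ∂(volume.restrict (Set.Ioi (0 : ℝ))),
    HasDerivAt z
      (α * posProj (derivWithin U (Set.Ici 0) (z t) - ∑ d, lam t N.source d) (z t)) t
  multiplier_ode : ∀ᵐ t ∂(volume.restrict (Set.Ioi (0 : ℝ))),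
    ∀ (v : V) (d : N.Receiver), v ≠ d.1 →
      HasDerivAt (fun τ => lam τ v d)
        (k v d * posProj (N.excess (z t) (f t) v d) (lam t v d)) t
  multiplier_dest : ∀ t ≥ 0, ∀ d : N.Receiver, lam t d.1 d = 0

/-- The time average over `[0, T]` of the flows. -/
noncomputable def averageFlow {V : Type*} (N : OverlayNetwork V) (f : ℝ → N.Flows) (T : ℝ) :
    N.Flows :=
  fun d v u => T⁻¹ * ∫ t in (0 : ℝ)..T, f t d v u

/-- The time average over `[0, T]` of the physical rates. -/
noncomputable def averageRate {V : Type*} (N : OverlayNetwork V) (g : ℝ → N.Rates) (T : ℝ) :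
    N.Rates :=
  fun v u => T⁻¹ * ∫ t in (0 : ℝ)..T, g t v u

end OverlayNetwork

/-! The proof is a Lyapunov argument around a saddle point of the partial Lagrangian. A primal
optimum exists by compactness, and strict concavity makes its rate unique. Dual multipliers come
from linear programming: an optimal point also maximizes the tangent of `U` at the optimal rate over
the polyhedral feasible set, so Farkas' lemma prices the conservation constraints without any Slater
condition (`exists_isDualOptimal`).

The scheduler enters only through one property, stable under perturbing the multipliers,
convexifying and closing: its decision is schedulable and minimizes the multiplier-weighted excess
over all schedules (`schedulable_and_weightedExcess_le_of_mem_fluidDecisions`). Hence, for every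
schedule `q`, the weighted squared distance to a dual optimal reference point decreases at least at
the rate (tangent gap of `U`) minus (weighted excess of `q` at the optimal rate). The discontinuous
decision has disappeared from this bound, which is continuous in the state. With `q` an optimal
schedule both terms have the good sign, so the state is bounded and Lipschitz in time.

A Lipschitz curve cannot return forever near a point where a convergent quantity drops at a definite
rate (`not_mapClusterPt_of_descent`); this stands in for LaSalle's principle. Applied to the
Lyapunov function for every `q`, it forces each cluster point to have the optimal rate and
nonnegative weighted excess for all schedules; applied to `z` and `-z`, it yields stationarity in
the rate. Cluster multipliers are therefore dual optimal. Re-centring the Lyapunov function at one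
of them makes its limit zero, so the whole trajectory converges.

The flows themselves need not converge. Their averages stay schedulable, and the average excess at a
node is at most the queue growth divided by `k T`, which vanishes because queues converge; every
limit of the averages is thus feasible at the optimal rate, hence optimal. -/

/-! ### Farkas' lemma and linear programming duality -/

/-- **Farkas' lemma** for finitely many linear functionals on a real vector space. -/
theorem exists_nonneg_combination_of_forall_nonpos {E ι : Type*} [AddCommGroup E] [Module ℝ E]
    (s : Finset ι) (a : ι → E →ₗ[ℝ] ℝ) (c : E →ₗ[ℝ] ℝ)
    (h : ∀ x, (∀ i ∈ s, a i x ≤ 0) → c x ≤ 0) :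
    ∃ y : ι → ℝ, (∀ i, 0 ≤ y i) ∧ ∀ x, c x = ∑ i ∈ s, y i * a i x := by
  classical
  induction s using Finset.induction_on generalizing a c with
  | empty =>
    refine ⟨0, fun _ => le_rfl, fun x => ?_⟩
    have h1 := h x (by simp)
    have h2 := h (-x) (by simp)
    rw [map_neg] at h2
    simp only [Finset.sum_empty]
    linarith
  | insert j s hj ih =>
    -- If the constraint `j` is redundant it gets weight zero. Otherwise some point violates only
    -- `j`, and projecting along it onto the kernel of `a j` eliminates that constraint.
    by_cases hs : ∀ x, (∀ i ∈ s, a i x ≤ 0) → c x ≤ 0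
    · obtain ⟨y, hy, hc⟩ := ih a c hs
      refine ⟨Function.update y j 0, fun i => ?_, fun x => ?_⟩
      · by_cases hij : i = j
        · simp [hij]
        · simpa [hij] using hy i
      · rw [hc x, Finset.sum_insert hj, Function.update_self, zero_mul, zero_add]
        refine Finset.sum_congr rfl fun i hi => ?_
        rw [Function.update_of_ne (ne_of_mem_of_not_mem hi hj)]
    · push Not at hs
      obtain ⟨x₁, hx₁, hcx₁⟩ := hs
      have hjx₁ : 0 < a j x₁ := by
        by_contra hle
        refine absurd (h x₁ fun i hi => ?_) (not_le.2 hcx₁)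
        rcases Finset.mem_insert.1 hi with rfl | hi
        · exact not_lt.1 hle
        · exact hx₁ i hi
      obtain ⟨x₀, hx₀, hcx₀, hjx₀⟩ : ∃ x₀, (∀ i ∈ s, a i x₀ ≤ 0) ∧ 0 < c x₀ ∧ a j x₀ = 1 := by
        refine ⟨(a j x₁)⁻¹ • x₁, fun i hi => ?_, ?_, ?_⟩
        · rw [map_smul, smul_eq_mul]
          exact mul_nonpos_of_nonneg_of_nonpos (inv_nonneg.2 hjx₁.le) (hx₁ i hi)
        · rw [map_smul, smul_eq_mul]
          exact mul_pos (inv_pos.2 hjx₁) hcx₁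
        · rw [map_smul, smul_eq_mul, inv_mul_cancel₀ hjx₁.ne']
      -- These functionals are `a i` and `c` composed with the projection `x ↦ x - a j x • x₀`.
      obtain ⟨y, hy, hc⟩ := ih (fun i => a i - a i x₀ • a j) (c - c x₀ • a j) (by
        intro x hx
        have := h (x - a j x • x₀) (by
          intro i hi
          rcases Finset.mem_insert.1 hi with rfl | hi
          · simp [hjx₀]
          · have := hx i hi
            simp only [LinearMap.sub_apply, LinearMap.smul_apply, smul_eq_mul, map_sub,
              map_smul] at this ⊢
            linarith)
        simp only [LinearMap.sub_apply, LinearMap.smul_apply, smul_eq_mul, map_sub,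
          map_smul] at this ⊢
        linarith)
      have hcoef : 0 ≤ c x₀ - ∑ i ∈ s, y i * a i x₀ := by
        have : ∑ i ∈ s, y i * a i x₀ ≤ 0 :=
          Finset.sum_nonpos fun i hi => mul_nonpos_of_nonneg_of_nonpos (hy i) (hx₀ i hi)
        linarith
      refine ⟨Function.update y j (c x₀ - ∑ i ∈ s, y i * a i x₀), fun i => ?_, fun x => ?_⟩
      · by_cases hij : i = j
        · subst hij; simpa using hcoef
        · simpa [hij] using hy i
      · rw [Finset.sum_insert hj, Function.update_self]
        have h1 : ∑ i ∈ s, Function.update y j (c x₀ - ∑ i ∈ s, y i * a i x₀) i * a i x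
            = ∑ i ∈ s, y i * a i x :=
          Finset.sum_congr rfl fun i hi => by
            rw [Function.update_of_ne (ne_of_mem_of_not_mem hi hj)]
        have h2 := hc x
        simp only [LinearMap.sub_apply, LinearMap.smul_apply, smul_eq_mul, mul_sub,
          Finset.sum_sub_distrib] at h2
        have h3 : ∑ i ∈ s, y i * (a i x₀ * a j x) = (∑ i ∈ s, y i * a i x₀) * a j x := by
          rw [Finset.sum_mul]
          exact Finset.sum_congr rfl fun i _ => by ring
        rw [h1]
        linarith

/-- A subset of a real vector space is polyhedral if it is cut out by finitely many affine
inequalities. -/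
def IsPolyhedral {E : Type*} [AddCommGroup E] [Module ℝ E] (S : Set E) : Prop :=
  ∃ H : Finset ((E →ₗ[ℝ] ℝ) × ℝ), S = {x | ∀ p ∈ H, p.1 x ≤ p.2}

namespace IsPolyhedral

variable {E : Type*} [AddCommGroup E] [Module ℝ E]

theorem halfspace (a : E →ₗ[ℝ] ℝ) (b : ℝ) : IsPolyhedral {x | a x ≤ b} :=
  ⟨{(a, b)}, by simp⟩

theorem inter {S T : Set E} (hS : IsPolyhedral S) (hT : IsPolyhedral T) :
    IsPolyhedral (S ∩ T) := by
  classical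
  obtain ⟨H, rfl⟩ := hS
  obtain ⟨K, rfl⟩ := hT
  refine ⟨H ∪ K, ?_⟩
  ext x
  simp only [Set.mem_inter_iff, Set.mem_ofPred_eq, Finset.mem_union]
  exact ⟨fun h p hp => hp.elim (h.1 p) (h.2 p), fun h => ⟨fun p hp => h p (.inl hp),
    fun p hp => h p (.inr hp)⟩⟩

theorem iInter {ι : Type*} [Finite ι] {S : ι → Set E} (hS : ∀ i, IsPolyhedral (S i)) :
    IsPolyhedral (⋂ i, S i) := by
  classical
  have := Fintype.ofFinite ι
  choose H hH using hS
  refine ⟨Finset.univ.biUnion H, ?_⟩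
  ext x
  simp only [Set.mem_iInter, hH, Set.mem_ofPred_eq, Finset.mem_biUnion, Finset.mem_univ, true_and]
  exact ⟨fun h p ⟨i, hp⟩ => h i p hp, fun h i p hp => h p ⟨i, hp⟩⟩

/-- **Lagrange duality** for linear programs: a linear functional that is bounded by `γ` on a
nonempty set, given by linear inequalities `e j x ≤ 0` over a polyhedral set, stays bounded
by `γ` over the polyhedral set when these inequalities are relaxed with suitable multipliers. -/
theorem exists_multipliers {J : Type*} [Fintype J] {S : Set E} (hS : IsPolyhedral S)
    (e : J → E →ₗ[ℝ] ℝ) (c : E →ₗ[ℝ] ℝ) (γ : ℝ) {x₀ : E} (hx₀ : x₀ ∈ S)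
    (hex₀ : ∀ j, e j x₀ ≤ 0) (h : ∀ x ∈ S, (∀ j, e j x ≤ 0) → c x ≤ γ) :
    ∃ y : J → ℝ, (∀ j, 0 ≤ y j) ∧ ∀ x ∈ S, c x - ∑ j, y j * e j x ≤ γ := by
  classical
  obtain ⟨H, rfl⟩ := hS
  let F : (E × ℝ) →ₗ[ℝ] E := LinearMap.fst ℝ E ℝ
  let T : (E × ℝ) →ₗ[ℝ] ℝ := LinearMap.snd ℝ E ℝ
  -- Homogenization: the affine constraints become a cone in `E × ℝ`, with `none` encoding `t ≥ 0`.
  -- The resulting identity is read off at `t = 1`.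
  let A : Option (J ⊕ H) → (E × ℝ) →ₗ[ℝ] ℝ := fun o =>
    match o with
    | none => -T
    | some (.inl j) => e j ∘ₗ F
    | some (.inr p) => p.1.1 ∘ₗ F - p.1.2 • T
  obtain ⟨y, hy, hc⟩ := exists_nonneg_combination_of_forall_nonpos Finset.univ A
    (c ∘ₗ F - γ • T) (by
      rintro ⟨x, t⟩ hx
      have ht : 0 ≤ t := by simpa [A, T] using hx none (Finset.mem_univ _)
      have hj : ∀ j, e j x ≤ 0 := fun j => by
        simpa [A, F] using hx (some (.inl j)) (Finset.mem_univ _)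
      have hp : ∀ p ∈ H, p.1 x ≤ p.2 * t := fun p hp => by
        simpa [A, F, T] using hx (some (.inr ⟨p, hp⟩)) (Finset.mem_univ _)
      have goal : c x ≤ γ * t := by
        rcases ht.eq_or_lt with rfl | ht
        -- At `t = 0` the vector `x` is a recession direction. If `c` increased along it, moving
        -- from the feasible point `x₀` would violate the bound `γ`.
        · by_contra hlt
          simp only [mul_zero, not_le] at hlt hp
          have key : ∀ r : ℝ, 0 ≤ r → c x₀ + r * c x ≤ γ := fun r hr => by
            have := h (x₀ + r • x) (fun p hpH => by
                rw [map_add, map_smul, smul_eq_mul]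
                have := mul_nonpos_of_nonneg_of_nonpos hr (hp p hpH)
                linarith [hx₀ p hpH]) (fun j => by
                rw [map_add, map_smul, smul_eq_mul]
                have := mul_nonpos_of_nonneg_of_nonpos hr (hj j)
                linarith [hex₀ j])
            simpa using this
          have h0 := key 0 le_rfl
          have h1 := key ((γ - c x₀ + 1) / c x) (div_nonneg (by linarith) hlt.le)
          rw [div_mul_cancel₀ _ hlt.ne'] at h1
          linarith
        · have := h (t⁻¹ • x) (fun p hpH => by
              rw [map_smul, smul_eq_mul, inv_mul_le_iff₀ ht, mul_comm]
              exact hp p hpH) (fun j => by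
              rw [map_smul, smul_eq_mul]
              exact mul_nonpos_of_nonneg_of_nonpos (inv_nonneg.2 ht.le) (hj j))
          rw [map_smul, smul_eq_mul, inv_mul_le_iff₀ ht] at this
          linarith
      simpa [F, T] using goal)
  refine ⟨fun j => y (some (.inl j)), fun j => hy _, fun x hx => ?_⟩
  have hcx := hc (x, 1)
  rw [Fintype.sum_option, Fintype.sum_sum_type] at hcx
  simp only [A, F, T, LinearMap.sub_apply, LinearMap.comp_apply, LinearMap.fst_apply,
    LinearMap.smul_apply, LinearMap.snd_apply, LinearMap.neg_apply, smul_eq_mul, mul_one] at hcx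
  have h1 : ∑ p : H, y (some (.inr p)) * (p.1.1 x - p.1.2) ≤ 0 :=
    Finset.sum_nonpos fun p _ =>
      mul_nonpos_of_nonneg_of_nonpos (hy _) (sub_nonpos.2 (hx p.1 p.2))
  have h2 := hy none
  linarith

end IsPolyhedral

/-! ### Descent along curves and time averages -/

namespace AbsolutelyContinuousOnInterval

/-- A function which is absolutely continuous and has derivative at most `m` almost everywhere
grows at rate at most `m`. -/
theorem sub_le_of_hasDerivAt_le {φ : ℝ → ℝ} {a b m : ℝ} (hab : a ≤ b)
    (hφ : AbsolutelyContinuousOnInterval φ a b)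
    (hd : ∀ᵐ t ∂(volume.restrict (Set.Ioo a b)), ∃ m' ≤ m, HasDerivAt φ m' t) :
    φ b - φ a ≤ m * (b - a) := by
  rw [← hφ.integral_deriv_eq_sub]
  calc ∫ t in a..b, deriv φ t ≤ ∫ _ in a..b, m := by
        refine intervalIntegral.integral_mono_ae_restrict hab
          hφ.intervalIntegrable_deriv intervalIntegrable_const ?_
        rw [← Measure.restrict_congr_set Ioo_ae_eq_Icc]
        filter_upwards [hd] with t ⟨m', hm', ht⟩
        rwa [ht.deriv]
    _ = m * (b - a) := by simp [mul_comm]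

end AbsolutelyContinuousOnInterval

/-- A curve which is Lipschitz on `[0, ∞)` has no cluster point near which a convergent quantity
decreases at a definite rate. -/
theorem not_mapClusterPt_of_descent {E : Type*} [PseudoMetricSpace E] {X : ℝ → E} {L : ℝ}
    (hX : ∀ s t, 0 ≤ s → s ≤ t → dist (X t) (X s) ≤ L * (t - s)) {W : ℝ → ℝ} {w : ℝ}
    (hW : Tendsto W atTop (𝓝 w)) {x : E} {O : Set E} (hO : O ∈ 𝓝 x) {ε : ℝ} (hε : 0 < ε)
    (h : ∀ a b, 0 ≤ a → a ≤ b → (∀ t ∈ Set.Icc a b, X t ∈ O) → W b - W a ≤ -ε * (b - a)) :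
    ¬ MapClusterPt x atTop X := by
  intro hx
  obtain ⟨r, hr, hrO⟩ := Metric.mem_nhds_iff.1 hO
  -- Within time `τ` a curve starting in the ball of radius `r / 2` stays in that of radius `r`, so
  -- `W` loses `ε * τ` at arbitrarily late times, against its convergence. The `+ 1` covers `L = 0`.
  set τ := r / (2 * (|L| + 1)) with hτ
  have hτ0 : 0 < τ := by positivity
  have hLτ : |L| * τ < r / 2 := by
    rw [hτ, mul_div_assoc', div_lt_div_iff₀ (by positivity) (by positivity)]
    nlinarith [abs_nonneg L]
  have hWτ : Tendsto (fun t => W (t + τ) - W t) atTop (𝓝 0) := by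
    simpa using (hW.comp (tendsto_atTop_add_const_right atTop τ tendsto_id)).sub hW
  have hev : ∀ᶠ t in atTop, -(ε * τ) < W (t + τ) - W t ∧ 0 ≤ t :=
    (hWτ.eventually (lt_mem_nhds (by simpa using mul_pos hε hτ0))).and (eventually_ge_atTop 0)
  obtain ⟨t, ht, hWt, ht0⟩ := ((mapClusterPt_iff_frequently.1 hx _
    (Metric.ball_mem_nhds x (half_pos hr))).and_eventually hev).exists
  have := h t (t + τ) ht0 (by linarith) fun s hs => hrO (by
    have h1 := hX t s ht0 hs.1
    have h2 : L * (s - t) ≤ |L| * τ :=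
      mul_le_mul (le_abs_self L) (by linarith [hs.2]) (by linarith [hs.1]) (abs_nonneg L)
    have h3 := dist_triangle (X s) (X t) x
    rw [Metric.mem_ball] at ht ⊢
    linarith)
  rw [add_sub_cancel_left] at this
  linarith

/-- The time average of a converging function converges to the same limit. -/
theorem tendsto_inv_mul_integral_of_tendsto {φ : ℝ → ℝ} {l : ℝ}
    (hφ : ∀ a b, 0 ≤ a → 0 ≤ b → IntervalIntegrable φ volume a b)
    (hl : Tendsto φ atTop (𝓝 l)) :
    Tendsto (fun T : ℝ => T⁻¹ * ∫ t in (0 : ℝ)..T, φ t) atTop (𝓝 l) := by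
  rw [Metric.tendsto_atTop]
  intro ε hε
  obtain ⟨S, hS⟩ := Metric.tendsto_atTop.1 hl (ε / 2) (half_pos hε)
  set S' := max S 0 with hS'
  set A := |∫ t in (0 : ℝ)..S', (φ t - l)| with hA
  -- Past `S'` the integrand is within `ε / 2` of the limit; past `2 * A / ε` the initial part
  -- contributes less than `ε / 2` to the average.
  refine ⟨max (S' + 1) (2 * A / ε + 1), fun T hT => ?_⟩
  have hS0 : 0 ≤ S' := le_max_right _ _
  have hTS : S' + 1 ≤ T := (le_max_left _ _).trans hT
  have hT0 : 0 < T := by linarith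
  have hTA : 2 * A / ε < T := by linarith [(le_max_right _ _).trans hT]
  have hint : ∀ a b, 0 ≤ a → 0 ≤ b → IntervalIntegrable (fun t => φ t - l) volume a b :=
    fun a b ha hb => (hφ a b ha hb).sub intervalIntegrable_const
  have h1 : T⁻¹ * (∫ t in (0 : ℝ)..T, φ t) - l = T⁻¹ * ∫ t in (0 : ℝ)..T, (φ t - l) := by
    rw [intervalIntegral.integral_sub (hφ 0 T le_rfl hT0.le) intervalIntegrable_const]
    simp only [intervalIntegral.integral_const, sub_zero, smul_eq_mul]
    field_simp
  have h2 : |∫ t in S'..T, (φ t - l)| ≤ ε / 2 * |T - S'| := by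
    rw [← Real.norm_eq_abs]
    refine intervalIntegral.norm_integral_le_of_norm_le_const fun t ht => ?_
    rw [Set.uIoc_of_le (by linarith)] at ht
    have := hS t ((le_max_left _ _).trans ht.1.le)
    rw [Real.dist_eq] at this
    exact this.le
  rw [abs_of_nonneg (show (0 : ℝ) ≤ T - S' by linarith)] at h2
  rw [Real.dist_eq, h1, abs_mul, abs_of_pos (inv_pos.2 hT0), inv_mul_lt_iff₀ hT0,
    ← intervalIntegral.integral_add_adjacent_intervals (hint 0 S' le_rfl hS0)
      (hint S' T hS0 hT0.le)]
  rw [div_lt_iff₀ hε] at hTA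
  refine (abs_add_le _ _).trans_lt ?_
  nlinarith

/-! ### Algebra of the flow excess -/

namespace OverlayNetwork

variable {V : Type*} [Fintype V] (N : OverlayNetwork V)

@[simp] theorem mem_outNbrs {v u : V} : u ∈ N.outNbrs v ↔ N.Link v u := by
  simp [outNbrs]

@[simp] theorem mem_inNbrs {v u : V} : u ∈ N.inNbrs v ↔ N.Link u v := by
  simp [inNbrs]

theorem inNbrs_source : N.inNbrs N.source = ∅ := by
  ext u
  simp [Link]

theorem excess_eq (z : ℝ) (f : N.Flows) (v : V) (d : N.Receiver) :
    N.excess z f v d = N.excess 0 f v d + z * N.excess 1 0 v d := by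
  classical
  simp only [excess, ite_self, Pi.zero_apply, Finset.sum_const_zero]
  split_ifs <;> ring

theorem excess_combo (a b z z' : ℝ) (f f' : N.Flows) (v : V) (d : N.Receiver) :
    N.excess (a * z + b * z') (a • f + b • f') v d
      = a * N.excess z f v d + b * N.excess z' f' v d := by
  classical
  simp only [excess, Pi.add_apply, Pi.smul_apply, smul_eq_mul, Finset.sum_add_distrib,
    ← Finset.mul_sum]
  split_ifs <;> ring

theorem continuous_excess (v : V) (d : N.Receiver) :
    Continuous fun x : ℝ × N.Flows => N.excess x.1 x.2 v d := by
  classical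
  unfold excess
  split_ifs <;> fun_prop

/-- The relaxed conservation constraints, weighted by the multipliers. -/
noncomputable def weightedExcess (lam : N.Multipliers) (z : ℝ) (f : N.Flows) : ℝ :=
  ∑ v : V, ∑ d : N.Receiver, lam v d * N.excess z f v d

theorem lagrangian_eq (U : ℝ → ℝ) (z : ℝ) (f : N.Flows) (lam : N.Multipliers) :
    N.lagrangian U z f lam = U z - N.weightedExcess lam z f := rfl

theorem weightedExcess_sub (lam mu : N.Multipliers) (z : ℝ) (f : N.Flows) :
    N.weightedExcess (lam - mu) z f = N.weightedExcess lam z f - N.weightedExcess mu z f := by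
  simp [weightedExcess, sub_mul, Finset.sum_sub_distrib]

/-- Injection occurs only at the source, so one unit of rate costs the total source queue length. -/
theorem weightedExcess_eq (lam : N.Multipliers) (z : ℝ) (f : N.Flows) :
    N.weightedExcess lam z f = N.weightedExcess lam 0 f + z * ∑ d, lam N.source d := by
  classical
  have h : ∑ v : V, ∑ d : N.Receiver, lam v d * N.excess 1 0 v d = ∑ d, lam N.source d := by
    rw [Finset.sum_eq_single N.source]
    · simp [excess]
    · intro v _ hv
      simp [excess, hv]
    · simp
  rw [← h]
  simp only [weightedExcess]
  rw [Finset.mul_sum, ← Finset.sum_add_distrib]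
  refine Finset.sum_congr rfl fun v _ => ?_
  rw [Finset.mul_sum, ← Finset.sum_add_distrib]
  refine Finset.sum_congr rfl fun d _ => ?_
  rw [N.excess_eq z f v d]
  ring

theorem weightedExcess_combo (lam : N.Multipliers) (a b z z' : ℝ) (f f' : N.Flows) :
    N.weightedExcess lam (a * z + b * z') (a • f + b • f')
      = a * N.weightedExcess lam z f + b * N.weightedExcess lam z' f' := by
  simp only [weightedExcess, excess_combo, Finset.mul_sum, ← Finset.sum_add_distrib]
  refine Finset.sum_congr rfl fun v _ => Finset.sum_congr rfl fun d _ => ?_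
  ring

theorem continuous_weightedExcess :
    Continuous fun x : N.Multipliers × ℝ × N.Flows => N.weightedExcess x.1 x.2.1 x.2.2 := by
  unfold weightedExcess
  refine continuous_finsetSum _ fun v _ => continuous_finsetSum _ fun d _ => ?_
  exact Continuous.mul (by fun_prop) ((N.continuous_excess v d).comp continuous_snd)

/-- Summation by parts: flow on a link counts positively at its head and negatively at its tail, so
each link sees only the queue difference. This is what back-pressure maximizes. -/
theorem weightedExcess_zero_eq (lam : N.Multipliers) (f : N.Flows) :
    N.weightedExcess lam 0 f
      = -∑ v : V, ∑ u ∈ N.outNbrs v, ∑ d : N.Receiver, (lam v d - lam u d) * f d v u := by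
  classical
  have h1 : ∀ d : N.Receiver, ∑ v : V, ∑ u ∈ N.inNbrs v, lam v d * f d u v
      = ∑ v : V, ∑ u ∈ N.outNbrs v, lam u d * f d v u := fun d =>
    Finset.sum_comm' (by simp)
  have h2 : N.weightedExcess lam 0 f
      = ∑ d : N.Receiver, ((∑ v : V, ∑ u ∈ N.inNbrs v, lam v d * f d u v)
          - ∑ v : V, ∑ u ∈ N.outNbrs v, lam v d * f d v u) := by
    rw [weightedExcess, Finset.sum_comm]
    refine Finset.sum_congr rfl fun d _ => ?_
    rw [← Finset.sum_sub_distrib]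
    refine Finset.sum_congr rfl fun v _ => ?_
    simp only [excess, ite_self, add_zero, mul_sub, Finset.mul_sum]
  rw [h2]
  simp_rw [h1, ← Finset.sum_sub_distrib]
  rw [Finset.sum_comm, ← Finset.sum_neg_distrib]
  refine Finset.sum_congr rfl fun v _ => ?_
  rw [Finset.sum_comm, ← Finset.sum_neg_distrib]
  refine Finset.sum_congr rfl fun u _ => ?_
  rw [← Finset.sum_neg_distrib]
  refine Finset.sum_congr rfl fun d _ => ?_
  ring

variable {N}

namespace Schedulable

theorem rate_le_capacity {f : N.Flows} {g : N.Rates} (h : N.Schedulable f g) (v u : V) :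
    g v u ≤ N.capacity v := by
  by_cases hvu : N.Link v u
  · exact (Finset.single_le_sum (fun w _ => h.rate_nonneg v w)
      (N.mem_outNbrs.2 hvu)).trans (h.upload v)
  · rw [h.rate_off_link v u hvu]
    exact N.capacity_nonneg v

theorem flow_le_rate {f : N.Flows} {g : N.Rates} (h : N.Schedulable f g) (d : N.Receiver)
    (v u : V) : f d v u ≤ g v u := by
  by_cases hvu : N.Link v u
  · exact h.piggyback d v u hvu
  · rw [h.flow_off_link d v u hvu]
    exact h.rate_nonneg v u

end Schedulable

variable (N)

/-! ### The polytope of schedules -/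

/-- The schedulable pairs of information flows and physical rates. -/
def scheduleSet : Set (N.Flows × N.Rates) := {p | N.Schedulable p.1 p.2}

theorem zero_mem_scheduleSet : (0 : N.Flows × N.Rates) ∈ N.scheduleSet where
  flow_nonneg := by simp
  rate_nonneg := by simp
  flow_off_link := by simp
  rate_off_link := by simp
  piggyback := by simp
  upload := by simpa using N.capacity_nonneg

theorem convex_scheduleSet : Convex ℝ N.scheduleSet := by
  intro p hp q hq a b ha hb hab
  refine ⟨fun d v u => ?_, fun v u => ?_, fun d v u h => ?_, fun v u h => ?_,
    fun d v u h => ?_, fun v => ?_⟩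
  · have := hp.flow_nonneg d v u
    have := hq.flow_nonneg d v u
    simp only [Prod.fst_add, Prod.smul_fst, Pi.add_apply, Pi.smul_apply, smul_eq_mul]
    positivity
  · have := hp.rate_nonneg v u
    have := hq.rate_nonneg v u
    simp only [Prod.snd_add, Prod.smul_snd, Pi.add_apply, Pi.smul_apply, smul_eq_mul]
    positivity
  · simp [hp.flow_off_link d v u h, hq.flow_off_link d v u h]
  · simp [hp.rate_off_link v u h, hq.rate_off_link v u h]
  · simp only [Prod.fst_add, Prod.smul_fst, Prod.snd_add, Prod.smul_snd, Pi.add_apply,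
      Pi.smul_apply, smul_eq_mul]
    exact add_le_add (mul_le_mul_of_nonneg_left (hp.piggyback d v u h) ha)
      (mul_le_mul_of_nonneg_left (hq.piggyback d v u h) hb)
  · simp only [Prod.snd_add, Prod.smul_snd, Pi.add_apply,
      Pi.smul_apply, smul_eq_mul, Finset.sum_add_distrib, ← Finset.mul_sum]
    calc _ ≤ a * N.capacity v + b * N.capacity v :=
          add_le_add (mul_le_mul_of_nonneg_left (hp.upload v) ha)
            (mul_le_mul_of_nonneg_left (hq.upload v) hb)
      _ = N.capacity v := by rw [← add_mul, hab, one_mul]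

/-- Off-link equalities become upper bounds, the lower ones being nonnegativity. The form with weak
inequalities only serves both closedness and polyhedrality. -/
theorem scheduleSet_eq : N.scheduleSet =
    (⋂ i : N.Receiver × V × V, {p | 0 ≤ p.1 i.1 i.2.1 i.2.2}) ∩
    (⋂ i : V × V, {p | 0 ≤ p.2 i.1 i.2}) ∩
    (⋂ i : {i : N.Receiver × V × V // ¬ N.Link i.2.1 i.2.2},
      {p | p.1 i.1.1 i.1.2.1 i.1.2.2 ≤ 0}) ∩
    (⋂ i : {i : V × V // ¬ N.Link i.1 i.2}, {p | p.2 i.1.1 i.1.2 ≤ 0}) ∩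
    (⋂ i : {i : N.Receiver × V × V // N.Link i.2.1 i.2.2},
      {p | p.1 i.1.1 i.1.2.1 i.1.2.2 ≤ p.2 i.1.2.1 i.1.2.2}) ∩
    (⋂ v : V, {p | ∑ u ∈ N.outNbrs v, p.2 v u ≤ N.capacity v}) := by
  ext p
  simp only [scheduleSet, Set.mem_inter_iff, Set.mem_iInter, Set.mem_ofPred_eq, Prod.forall,
    Subtype.forall]
  constructor
  · intro h
    exact ⟨⟨⟨⟨⟨fun d hd v u => h.flow_nonneg ⟨d, hd⟩ v u, h.rate_nonneg⟩,
      fun d hd v u hvu => (h.flow_off_link ⟨d, hd⟩ v u hvu).le⟩,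
      fun v u hvu => (h.rate_off_link v u hvu).le⟩,
      fun d hd v u hvu => h.piggyback ⟨d, hd⟩ v u hvu⟩, h.upload⟩
  · rintro ⟨⟨⟨⟨⟨h1, h2⟩, h3⟩, h4⟩, h5⟩, h6⟩
    exact ⟨fun d v u => h1 d.1 d.2 v u, h2,
      fun d v u hvu => le_antisymm (h3 d.1 d.2 v u hvu) (h1 d.1 d.2 v u),
      fun v u hvu => le_antisymm (h4 v u hvu) (h2 v u), fun d v u hvu => h5 d.1 d.2 v u hvu, h6⟩

theorem isClosed_scheduleSet : IsClosed N.scheduleSet := by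
  rw [scheduleSet_eq]
  refine (((((IsClosed.inter ?_ ?_).inter ?_).inter ?_).inter ?_).inter ?_) <;>
    exact isClosed_iInter fun i => isClosed_le (by fun_prop) (by fun_prop)

theorem isCompact_scheduleSet : IsCompact N.scheduleSet := by
  refine Metric.isCompact_of_isClosed_isBounded N.isClosed_scheduleSet ?_
  refine (Metric.isBounded_Icc (0 : N.Flows × N.Rates)
    (fun _ v _ => N.capacity v, fun v _ => N.capacity v)).subset fun p hp => ?_
  exact ⟨⟨fun d v u => hp.flow_nonneg d v u, fun v u => hp.rate_nonneg v u⟩,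
    ⟨fun d v u => (hp.flow_le_rate d v u).trans (hp.rate_le_capacity v u),
      fun v u => hp.rate_le_capacity v u⟩⟩

theorem exists_sum_abs_excess_le : ∃ B : ℝ, 0 ≤ B ∧ ∀ p ∈ N.scheduleSet,
    ∑ v : V, ∑ d : N.Receiver, |N.excess 0 p.1 v d| ≤ B := by
  obtain ⟨B, hB⟩ := N.isCompact_scheduleSet.exists_bound_of_continuousOn
    (f := fun p => ∑ v : V, ∑ d : N.Receiver, |N.excess 0 p.1 v d|)
    (Continuous.continuousOn (continuous_finsetSum _ fun v _ => continuous_finsetSum _ fun d _ =>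
      ((N.continuous_excess v d).comp (Continuous.prodMk_right (0 : ℝ) |>.comp continuous_fst)).abs))
  refine ⟨B, (norm_nonneg _).trans (hB _ N.zero_mem_scheduleSet), fun p hp => ?_⟩
  exact (le_abs_self _).trans (hB p hp)

variable {N}

/-! ### Optimality of back-pressure decisions and of their convexification -/

theorem IsBackPressureDecision.schedulable {mu : N.Multipliers} {p : N.Flows × N.Rates}
    (h : N.IsBackPressureDecision mu p) : p ∈ N.scheduleSet := by
  classical
  obtain ⟨next, -, h2, h3⟩ := h
  have hg : ∀ v u, 0 ≤ p.2 v u := fun v u => by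
    rw [h2]
    split_ifs
    exacts [N.capacity_nonneg v, le_rfl]
  have hg' : ∀ v u, ¬ N.Link v u → p.2 v u = 0 := fun v u hvu => by
    simp [h2, hvu]
  refine ⟨fun d v u => ?_, hg, fun d v u hvu => ?_, hg', fun d v u _ => ?_, fun v => ?_⟩
  · rw [h3]
    split_ifs
    exacts [le_rfl, hg v u]
  · rw [h3, hg' v u hvu, ite_self]
  · rw [h3]
    split_ifs
    exacts [hg v u, le_rfl]
  · simp_rw [h2]
    calc ∑ u ∈ N.outNbrs v, (if u ∈ N.outNbrs v ∧ u = next v then N.capacity v else 0)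
        ≤ ∑ u ∈ N.outNbrs v, if u = next v then N.capacity v else 0 := by
          refine Finset.sum_le_sum fun u hu => ?_
          simp [hu]
      _ ≤ N.capacity v := by
          rw [Finset.sum_ite_eq']
          split_ifs
          exacts [le_rfl, N.capacity_nonneg v]

/-- Back-pressure decisions maximize the multiplier-weighted net outflow. -/
theorem IsBackPressureDecision.weightedExcess_le {mu : N.Multipliers} {p : N.Flows × N.Rates}
    (h : N.IsBackPressureDecision mu p) {q : N.Flows × N.Rates} (hq : q ∈ N.scheduleSet) :
    N.weightedExcess mu 0 p.1 ≤ N.weightedExcess mu 0 q.1 := by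
  classical
  obtain ⟨next, h1, h2, h3⟩ := h
  rw [weightedExcess_zero_eq, weightedExcess_zero_eq, neg_le_neg_iff]
  refine Finset.sum_le_sum fun v _ => ?_
  rcases (N.outNbrs v).eq_empty_or_nonempty with hv | hv
  · simp [hv]
  obtain ⟨hnext, hmax⟩ := h1 v hv
  have hw : 0 ≤ N.backPressure mu v (next v) := Finset.sum_nonneg fun d _ => le_max_right _ _
  -- The upper bound drops negative differences, replaces flows by physical rates and spends the
  -- whole capacity on the best neighbor. The back-pressure decision attains it.
  calc ∑ u ∈ N.outNbrs v, ∑ d : N.Receiver, (mu v d - mu u d) * q.1 d v u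
      ≤ ∑ u ∈ N.outNbrs v, N.backPressure mu v (next v) * q.2 v u := by
        refine Finset.sum_le_sum fun u hu => ?_
        calc ∑ d : N.Receiver, (mu v d - mu u d) * q.1 d v u
            ≤ ∑ d : N.Receiver, max (mu v d - mu u d) 0 * q.2 v u :=
              Finset.sum_le_sum fun d _ => mul_le_mul (le_max_left _ _) (hq.flow_le_rate d v u)
                (hq.flow_nonneg d v u) (le_max_right _ _)
          _ = N.backPressure mu v u * q.2 v u := by rw [backPressure, Finset.sum_mul]
          _ ≤ _ := mul_le_mul_of_nonneg_right (hmax u hu) (hq.rate_nonneg v u)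
    _ ≤ N.backPressure mu v (next v) * N.capacity v := by
        rw [← Finset.mul_sum]
        exact mul_le_mul_of_nonneg_left (hq.upload v) hw
    _ = ∑ d : N.Receiver, (mu v d - mu (next v) d) * p.1 d v (next v) := by
        rw [backPressure, Finset.sum_mul]
        refine Finset.sum_congr rfl fun d _ => ?_
        have hg : p.2 v (next v) = N.capacity v := by rw [h2, if_pos ⟨hnext, rfl⟩]
        rw [h3, hg]
        split_ifs with hd
        · rw [max_eq_right hd, zero_mul, mul_zero]
        · rw [max_eq_left (not_le.1 hd).le]
    _ = ∑ u ∈ N.outNbrs v, ∑ d : N.Receiver, (mu v d - mu u d) * p.1 d v u := by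
        rw [Finset.sum_eq_single_of_mem _ hnext]
        intro u _ hu
        refine Finset.sum_eq_zero fun d _ => ?_
        have hg : p.2 v u = 0 := by rw [h2, if_neg fun h => hu h.2]
        rw [h3, hg, ite_self, mul_zero]

theorem abs_weightedExcess_le (lam : N.Multipliers) {ε : ℝ} (hε : ∀ v d, |lam v d| ≤ ε)
    (f : N.Flows) : |N.weightedExcess lam 0 f|
      ≤ ε * ∑ v : V, ∑ d : N.Receiver, |N.excess 0 f v d| := by
  rw [weightedExcess, Finset.mul_sum]
  refine (Finset.abs_sum_le_sum_abs _ _).trans (Finset.sum_le_sum fun v _ => ?_)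
  rw [Finset.mul_sum]
  refine (Finset.abs_sum_le_sum_abs _ _).trans (Finset.sum_le_sum fun d _ => ?_)
  rw [abs_mul]
  exact mul_le_mul_of_nonneg_right (hε v d) (abs_nonneg _)

theorem weightedExcess_comb_zero (lam : N.Multipliers) (a b : ℝ) (f f' : N.Flows) :
    N.weightedExcess lam 0 (a • f + b • f')
      = a * N.weightedExcess lam 0 f + b * N.weightedExcess lam 0 f' := by
  simpa using N.weightedExcess_combo lam a b 0 0 f f'

/-- The convexified scheduler makes schedulable decisions which maximize the multiplier-weighted
net outflow. -/
theorem schedulable_and_weightedExcess_le_of_mem_fluidDecisions {lam : N.Multipliers}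
    {p : N.Flows × N.Rates} (hp : p ∈ N.fluidDecisions lam) :
    p ∈ N.scheduleSet ∧ ∀ q ∈ N.scheduleSet,
      N.weightedExcess lam 0 p.1 ≤ N.weightedExcess lam 0 q.1 := by
  obtain ⟨B, hB0, hB⟩ := N.exists_sum_abs_excess_le
  have key : ∀ ε > 0, p ∈ N.scheduleSet ∧ ∀ q ∈ N.scheduleSet,
      N.weightedExcess lam 0 p.1 ≤ N.weightedExcess lam 0 q.1 + 2 * B * ε := by
    intro ε hε
    have hp' := Set.mem_iInter₂.1 hp ε hε
    -- Replacing `mu` by `lam` costs at most `B * ε` on each side of the comparison. The relaxed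
    -- optimality condition is closed and convex, so it survives the convexification; afterwards `ε`
    -- tends to zero.
    let S : Set (N.Flows × N.Rates) := N.scheduleSet ∩ {p | ∀ q ∈ N.scheduleSet,
      N.weightedExcess lam 0 p.1 ≤ N.weightedExcess lam 0 q.1 + 2 * B * ε}
    have hScl : IsClosed S := by
      refine N.isClosed_scheduleSet.inter ?_
      simp only [Set.ofPred_forall]
      refine isClosed_iInter fun q => isClosed_iInter fun _ => isClosed_le ?_ continuous_const
      exact N.continuous_weightedExcess.comp
        (f := fun p : N.Flows × N.Rates => (lam, (0 : ℝ), p.1)) (by fun_prop)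
    have hScv : Convex ℝ S := by
      refine N.convex_scheduleSet.inter ?_
      intro x hx y hy a b ha hb hab q hq
      rw [Prod.fst_add, Prod.smul_fst, Prod.smul_fst, weightedExcess_comb_zero]
      calc _ ≤ a * (N.weightedExcess lam 0 q.1 + 2 * B * ε)
            + b * (N.weightedExcess lam 0 q.1 + 2 * B * ε) :=
            add_le_add (mul_le_mul_of_nonneg_left (hx q hq) ha)
              (mul_le_mul_of_nonneg_left (hy q hq) hb)
        _ = _ := by rw [← add_mul, hab, one_mul]
    refine closure_minimal (convexHull_min ?_ hScv) hScl hp'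
    rintro r ⟨mu, -, hmu, hr⟩
    refine ⟨hr.schedulable, fun q hq => ?_⟩
    have hdist : ∀ v d, |(lam - mu) v d| ≤ ε := fun v d => by
      have h1 : dist (lam v d) (mu v d) ≤ dist lam mu :=
        (dist_le_pi_dist (lam v) (mu v) d).trans (dist_le_pi_dist lam mu v)
      rw [dist_comm lam, Real.dist_eq] at h1
      exact h1.trans hmu.le
    have hle : ∀ s ∈ N.scheduleSet,
        |N.weightedExcess lam 0 s.1 - N.weightedExcess mu 0 s.1| ≤ B * ε := fun s hs => by
      rw [← weightedExcess_sub]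
      refine (abs_weightedExcess_le _ hdist _).trans ?_
      rw [mul_comm]
      exact mul_le_mul_of_nonneg_right (hB s hs) hε.le
    have h1 := abs_le.1 (hle r hr.schedulable)
    have h2 := abs_le.1 (hle q hq)
    have h3 := hr.weightedExcess_le hq
    linarith [h1.2, h2.1]
  refine ⟨(key 1 one_pos).1, fun q hq => le_of_forall_pos_le_add fun δ hδ => ?_⟩
  refine ((key (δ / (2 * B + 1)) (by positivity)).2 q hq).trans ?_
  gcongr
  rw [mul_div_assoc', div_le_iff₀ (by positivity)]
  nlinarith

end OverlayNetwork

/-! ### Tangents, primal optima and dual multipliers -/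

/-- A strictly concave function lies strictly below its tangents. -/
theorem StrictConcaveOn.lt_tangent {U : ℝ → ℝ} (hU : StrictConcaveOn ℝ (Set.Ici 0) U)
    (hU1 : DifferentiableOn ℝ U (Set.Ici 0)) {x y : ℝ} (hx : 0 ≤ x) (hy : 0 ≤ y) (hxy : y ≠ x) :
    U y < U x + derivWithin U (Set.Ici 0) x * (y - x) := by
  rcases lt_or_gt_of_ne hxy with h | h
  · have := hU.derivWithin_lt_slope hy hx h (hU1 x hx)
    rw [slope_def_field, lt_div_iff₀ (by linarith)] at this
    linarith
  · have := hU.slope_lt_derivWithin hx hy h (hU1 x hx)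
    rw [slope_def_field, div_lt_iff₀ (by linarith)] at this
    linarith

theorem StrictConcaveOn.le_tangent {U : ℝ → ℝ} (hU : StrictConcaveOn ℝ (Set.Ici 0) U)
    (hU1 : DifferentiableOn ℝ U (Set.Ici 0)) {x y : ℝ} (hx : 0 ≤ x) (hy : 0 ≤ y) :
    U y ≤ U x + derivWithin U (Set.Ici 0) x * (y - x) := by
  rcases eq_or_ne y x with rfl | h
  · simp
  · exact (hU.lt_tangent hU1 hx hy h).le

namespace OverlayNetwork

variable {V : Type*} [Fintype V] {N : OverlayNetwork V}

/-- The source has no incoming links, so for any single receiver the whole injected rate must leave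
on its outgoing links. This bound makes the feasible set compact. -/
theorem Feasible.broadcast_le [Nontrivial V] {x : ℝ × N.Flows × N.Rates} (hx : N.Feasible x) :
    x.1 ≤ N.capacity N.source := by
  classical
  obtain ⟨d, hd⟩ := exists_ne N.source
  have h := hx.conservation ⟨d, hd⟩ N.source hd.symm
  simp only [excess, inNbrs_source, Finset.sum_empty, if_true, zero_add] at h
  have h2 : ∑ u ∈ N.outNbrs N.source, x.2.1 ⟨d, hd⟩ N.source u
      ≤ ∑ u ∈ N.outNbrs N.source, x.2.2 N.source u :=
    Finset.sum_le_sum fun u _ => hx.schedulable.flow_le_rate _ _ u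
  linarith [hx.schedulable.upload N.source]

variable (N)

theorem feasible_zero : N.Feasible 0 where
  broadcast_nonneg := le_rfl
  schedulable := N.zero_mem_scheduleSet
  conservation := by
    intro d v _
    simp [excess]

theorem isClosed_setOf_feasible : IsClosed {x | N.Feasible x} := by
  have : {x | N.Feasible x} = {x | 0 ≤ x.1} ∩ (Prod.snd ⁻¹' N.scheduleSet) ∩
      ⋂ i : {i : V × N.Receiver // i.1 ≠ i.2.1}, {x | N.excess x.1 x.2.1 i.1.1 i.1.2 ≤ 0} := by
    ext x
    simp only [Set.mem_inter_iff, Set.mem_iInter, Set.mem_ofPred_eq, Set.mem_preimage]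
    exact ⟨fun h => ⟨⟨h.1, h.2⟩, fun i => h.3 i.1.2 i.1.1 i.2⟩,
      fun h => ⟨h.1.1, h.1.2, fun d v hv => h.2 ⟨(v, d), hv⟩⟩⟩
  rw [this]
  refine (IsClosed.inter (isClosed_le continuous_const continuous_fst)
    (N.isClosed_scheduleSet.preimage continuous_snd)).inter (isClosed_iInter fun i => ?_)
  exact isClosed_le ((N.continuous_excess i.1.1 i.1.2).comp
    (f := fun x : ℝ × N.Flows × N.Rates => (x.1, x.2.1)) (by fun_prop)) continuous_const

theorem isCompact_setOf_feasible [Nontrivial V] : IsCompact {x | N.Feasible x} :=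
  (isCompact_Icc.prod N.isCompact_scheduleSet).of_isClosed_subset N.isClosed_setOf_feasible
    fun _ hx => ⟨⟨hx.broadcast_nonneg, hx.broadcast_le⟩, hx.schedulable⟩

variable {N} in
theorem Feasible.combo {x y : ℝ × N.Flows × N.Rates} (hx : N.Feasible x) (hy : N.Feasible y)
    {a b : ℝ} (ha : 0 ≤ a) (hb : 0 ≤ b) (hab : a + b = 1) : N.Feasible (a • x + b • y) where
  broadcast_nonneg := by
    have := hx.broadcast_nonneg
    have := hy.broadcast_nonneg
    simp only [Prod.fst_add, Prod.smul_fst, smul_eq_mul]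
    positivity
  schedulable := N.convex_scheduleSet hx.schedulable hy.schedulable ha hb hab
  conservation := fun d v hv => by
    have h := N.excess_combo a b x.1 y.1 x.2.1 y.2.1 v d
    simp only [Prod.fst_add, Prod.smul_fst, Prod.snd_add, Prod.smul_snd, smul_eq_mul]
    rw [h]
    exact add_nonpos (mul_nonpos_of_nonneg_of_nonpos ha (hx.conservation d v hv))
      (mul_nonpos_of_nonneg_of_nonpos hb (hy.conservation d v hv))

theorem optimalSet_nonempty [Nontrivial V] {U : ℝ → ℝ} (hU : ContinuousOn U (Set.Ici 0)) :
    (N.optimalSet U).Nonempty := by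
  obtain ⟨x, hx, hmax⟩ := N.isCompact_setOf_feasible.exists_isMaxOn ⟨0, N.feasible_zero⟩
    (f := fun x => U x.1) (hU.comp continuousOn_fst fun x hx => hx.broadcast_nonneg)
  exact ⟨x, hx, fun y hy => hmax hy⟩

variable {N}

theorem optimalSet_rate_unique {U : ℝ → ℝ} (hU : StrictConcaveOn ℝ (Set.Ici 0) U)
    {x y : ℝ × N.Flows × N.Rates} (hx : x ∈ N.optimalSet U) (hy : y ∈ N.optimalSet U) :
    x.1 = y.1 := by
  by_contra hne
  have h1 := hU.2 hx.1.broadcast_nonneg hy.1.broadcast_nonneg hne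
    (one_half_pos (α := ℝ)) one_half_pos (add_halves 1)
  have h2 := hx.2 _ (hx.1.combo hy.1 (a := 1 / 2) (b := 1 / 2)
    (by norm_num) (by norm_num) (by norm_num))
  have h3 := hx.2 y hy.1
  have h4 := hy.2 x hx.1
  simp only [Prod.fst_add, Prod.smul_fst, smul_eq_mul] at h1 h2
  linarith

theorem mem_optimalSet_of_rate_eq {U : ℝ → ℝ} {x y : ℝ × N.Flows × N.Rates}
    (hx : x ∈ N.optimalSet U) (hy : N.Feasible y) (h : y.1 = x.1) : y ∈ N.optimalSet U :=
  ⟨hy, by rw [h]; exact hx.2⟩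

theorem weightedExcess_nonpos {x : ℝ × N.Flows × N.Rates} (hx : N.Feasible x)
    {lam : N.Multipliers} (hlam : lam ∈ N.multiplierSet) :
    N.weightedExcess lam x.1 x.2.1 ≤ 0 := by
  refine Finset.sum_nonpos fun v _ => Finset.sum_nonpos fun d _ => ?_
  by_cases hv : v = d.1
  · rw [hv, hlam.2 d, zero_mul]
  · exact mul_nonpos_of_nonneg_of_nonpos (hlam.1 v d) (hx.conservation d v hv)

/-- Admissible multipliers at which the dual function is at most `U zopt`. -/
structure IsDualOptimal (N : OverlayNetwork V) (U : ℝ → ℝ) (zopt : ℝ) (lam : N.Multipliers) :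
    Prop where
  mem_multiplierSet : lam ∈ N.multiplierSet
  lagrangian_le : ∀ z : ℝ, 0 ≤ z → ∀ p ∈ N.scheduleSet, N.lagrangian U z p.1 lam ≤ U zopt

/-- `U x.1` separates both sides: dual optimality puts the Lagrangian at `lam` below it, and
feasibility of `x` puts the Lagrangian at `x` above it for every admissible multiplier. -/
theorem IsDualOptimal.isSaddlePoint {U : ℝ → ℝ} {lam : N.Multipliers}
    {x : ℝ × N.Flows × N.Rates} (h : N.IsDualOptimal U x.1 lam) (hx : x ∈ N.optimalSet U) :
    N.IsSaddlePoint U x lam := by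
  have hle : ∀ mu ∈ N.multiplierSet, U x.1 ≤ N.lagrangian U x.1 x.2.1 mu := fun mu hmu => by
    rw [lagrangian_eq]
    linarith [weightedExcess_nonpos hx.1 hmu]
  have hxs : x.2 ∈ N.scheduleSet := hx.1.schedulable
  exact ⟨hx.1.broadcast_nonneg, hxs, h.mem_multiplierSet,
    fun y hy hys => (h.lagrangian_le y.1 hy y.2 hys).trans (hle lam h.mem_multiplierSet),
    fun mu hmu => (h.lagrangian_le x.1 hx.1.broadcast_nonneg x.2 hxs).trans (hle mu hmu)⟩

variable (N)

theorem isPolyhedral_relaxation :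
    IsPolyhedral {x : ℝ × N.Flows × N.Rates | 0 ≤ x.1 ∧ x.2 ∈ N.scheduleSet} := by
  let Z : (ℝ × N.Flows × N.Rates) →ₗ[ℝ] ℝ := LinearMap.fst ℝ _ _
  let F : N.Receiver → V → V → (ℝ × N.Flows × N.Rates) →ₗ[ℝ] ℝ := fun d v u =>
    LinearMap.proj u ∘ₗ LinearMap.proj v ∘ₗ LinearMap.proj d ∘ₗ LinearMap.fst ℝ N.Flows N.Rates ∘ₗ
      LinearMap.snd ℝ ℝ (N.Flows × N.Rates)
  let G : V → V → (ℝ × N.Flows × N.Rates) →ₗ[ℝ] ℝ := fun v u =>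
    LinearMap.proj u ∘ₗ LinearMap.proj v ∘ₗ LinearMap.snd ℝ N.Flows N.Rates ∘ₗ
      LinearMap.snd ℝ ℝ (N.Flows × N.Rates)
  have h : {x : ℝ × N.Flows × N.Rates | 0 ≤ x.1 ∧ x.2 ∈ N.scheduleSet} =
      {x | (-Z) x ≤ 0} ∩
      ((⋂ i : N.Receiver × V × V, {x | (-F i.1 i.2.1 i.2.2) x ≤ 0}) ∩
      (⋂ i : V × V, {x | (-G i.1 i.2) x ≤ 0}) ∩
      (⋂ i : {i : N.Receiver × V × V // ¬ N.Link i.2.1 i.2.2},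
        {x | F i.1.1 i.1.2.1 i.1.2.2 x ≤ 0}) ∩
      (⋂ i : {i : V × V // ¬ N.Link i.1 i.2}, {x | G i.1.1 i.1.2 x ≤ 0}) ∩
      (⋂ i : {i : N.Receiver × V × V // N.Link i.2.1 i.2.2},
        {x | (F i.1.1 i.1.2.1 i.1.2.2 - G i.1.2.1 i.1.2.2) x ≤ 0}) ∩
      (⋂ v : V, {x | (∑ u ∈ N.outNbrs v, G v u) x ≤ N.capacity v})) := by
    rw [scheduleSet_eq]
    ext x
    simp [Z, F, G]
  rw [h]
  refine (IsPolyhedral.halfspace _ _).inter (((((IsPolyhedral.inter ?_ ?_).inter ?_).inter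
    ?_).inter ?_).inter ?_) <;>
    exact IsPolyhedral.iInter fun i => IsPolyhedral.halfspace _ _

variable {N}

/-- Linearize `U` at the optimum, apply duality to the resulting linear program, and return to `U`
through its tangent inequality. -/
theorem exists_isDualOptimal {U : ℝ → ℝ} (hU : StrictConcaveOn ℝ (Set.Ici 0) U)
    (hU1 : DifferentiableOn ℝ U (Set.Ici 0)) {x : ℝ × N.Flows × N.Rates}
    (hx : x ∈ N.optimalSet U) : ∃ lam, N.IsDualOptimal U x.1 lam := by
  classical
  set c := derivWithin U (Set.Ici 0) x.1 with hc
  -- First-order condition along the segment from `x` to `y`; the one-sided derivative also covers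
  -- an optimal rate zero.
  have hopt : ∀ y, N.Feasible y → c * y.1 ≤ c * x.1 := by
    intro y hy
    have hx0 := hx.1.broadcast_nonneg
    have hy0 := hy.broadcast_nonneg
    by_contra hlt
    have hpos : 0 < c * (y.1 - x.1) := by linarith
    have hder : HasDerivWithinAt U c (Set.Ici 0) x.1 := (hU1 x.1 hx0).hasDerivWithinAt
    have hline : HasDerivWithinAt (fun s : ℝ => (1 - s) * x.1 + s * y.1) (y.1 - x.1)
        (Set.Icc 0 1) 0 := by
      have h1 : HasDerivAt (fun s : ℝ => (1 - s) * x.1 + s * y.1) (-1 * x.1 + 1 * y.1) 0 :=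
        (((hasDerivAt_id (0 : ℝ)).const_sub 1).mul_const x.1).add
          ((hasDerivAt_id (0 : ℝ)).mul_const y.1)
      rw [neg_one_mul, one_mul, neg_add_eq_sub] at h1
      exact h1.hasDerivWithinAt
    have hcomp : HasDerivWithinAt (fun s : ℝ => U ((1 - s) * x.1 + s * y.1)) (c * (y.1 - x.1))
        (Set.Icc 0 1) 0 := by
      refine HasDerivWithinAt.comp (h₂ := U) 0 (s' := Set.Ici 0) (by simpa using hder) hline
        fun s hs => ?_
      have := hs.1
      have : 0 ≤ 1 - s := by linarith [hs.2]
      simp only [Set.mem_Ici]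
      positivity
    have hmax : IsMaxOn (fun s : ℝ => U ((1 - s) * x.1 + s * y.1)) (Set.Icc 0 1) 0 := by
      intro s hs
      have := hx.2 _ (hx.1.combo hy (a := 1 - s) (b := s) (by linarith [hs.2]) hs.1 (by ring))
      simpa using this
    have := hmax.localize.hasFDerivWithinAt_nonpos hcomp.hasFDerivWithinAt (y := 1)
      (mem_posTangentConeAt_of_segment_subset (by simp [segment_eq_Icc]))
    simp at this
    linarith
  -- No conservation is imposed at a destination: the constraint is replaced by zero there, so its
  -- multiplier can be reset to zero.
  let e : V × N.Receiver → (ℝ × N.Flows × N.Rates) →ₗ[ℝ] ℝ := fun i =>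
    if i.1 = i.2.1 then 0 else IsLinearMap.mk' (fun x => N.excess x.1 x.2.1 i.1 i.2)
      ⟨fun x y => by simpa using N.excess_combo 1 1 x.1 y.1 x.2.1 y.2.1 i.1 i.2,
        fun a x => by simpa using N.excess_combo a 0 x.1 x.1 x.2.1 x.2.1 i.1 i.2⟩
  have he : ∀ v d y, v ≠ d.1 → e (v, d) y = N.excess y.1 y.2.1 v d := fun v d y hv => by
    simp [e, hv]
  have he0 : ∀ v d y, v = d.1 → e (v, d) y = 0 := fun v d y hv => by
    simp [e, hv]
  obtain ⟨lam, hlam, hle⟩ := N.isPolyhedral_relaxation.exists_multipliers e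
    (c • LinearMap.fst ℝ _ _) (c * x.1) (x₀ := 0) ⟨le_rfl, N.zero_mem_scheduleSet⟩
    (fun j => by simp) (by
      intro y hy hey
      refine hopt y ⟨hy.1, hy.2, fun d v hv => ?_⟩
      rw [← he v d y hv]
      exact hey _)
  refine ⟨fun v d => if v = d.1 then 0 else lam (v, d), ⟨fun v d => ?_, fun d => ?_⟩,
    fun z hz p hp => ?_⟩
  · dsimp only
    split_ifs
    exacts [le_rfl, hlam _]
  · simp
  · have h1 := hle (z, p) ⟨hz, hp⟩
    have h2 : N.weightedExcess (fun v d => if v = d.1 then 0 else lam (v, d)) z p.1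
        = ∑ j, lam j * e j (z, p) := by
      rw [weightedExcess, Fintype.sum_prod_type]
      refine Finset.sum_congr rfl fun v _ => Finset.sum_congr rfl fun d _ => ?_
      by_cases hv : v = d.1
      · rw [if_pos hv, he0 v d _ hv, zero_mul, mul_zero]
      · rw [if_neg hv, he v d _ hv]
    rw [lagrangian_eq, h2]
    have h3 := hU.le_tangent hU1 hx.1.broadcast_nonneg hz
    simp only [LinearMap.smul_apply, LinearMap.fst_apply, smul_eq_mul] at h1
    rw [← hc] at h3
    linarith

end OverlayNetwork

/-! ### Absolutely continuous functions on the half-line -/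

section HalfLine

variable {φ : ℝ → ℝ}

theorem absolutelyContinuousOnInterval_of_forall_pos
    (hφ : ∀ T > 0, AbsolutelyContinuousOnInterval φ 0 T) {a b : ℝ} (ha : 0 ≤ a) (hab : a ≤ b) :
    AbsolutelyContinuousOnInterval φ a b := by
  refine (hφ (b + 1) (by linarith)).mono ?_
  rw [Set.uIcc_of_le hab, Set.uIcc_of_le (by linarith)]
  exact Set.Icc_subset_Icc ha (by linarith)

theorem continuousOn_Ici_of_absolutelyContinuousOnInterval
    (hφ : ∀ T > 0, AbsolutelyContinuousOnInterval φ 0 T) : ContinuousOn φ (Set.Ici 0) := by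
  intro t ht
  have h := (hφ (t + 1) (by linarith [Set.mem_Ici.1 ht])).continuousOn t
  rw [Set.uIcc_of_le (by linarith [Set.mem_Ici.1 ht])] at h
  refine (h ⟨Set.mem_Ici.1 ht, (lt_add_one t).le⟩).mono_of_mem_nhdsWithin ?_
  rw [← Set.Ici_inter_Iic]
  exact inter_mem_nhdsWithin _ (Iic_mem_nhds (lt_add_one t))

theorem sub_le_of_ae_hasDerivAt_le (hφ : ∀ T > 0, AbsolutelyContinuousOnInterval φ 0 T)
    {a b m : ℝ} (ha : 0 ≤ a) (hab : a ≤ b)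
    (hd : ∀ᵐ t ∂(volume.restrict (Set.Ioi (0 : ℝ))), t ∈ Set.Ioo a b →
      ∃ m' ≤ m, HasDerivAt φ m' t) : φ b - φ a ≤ m * (b - a) := by
  refine (absolutelyContinuousOnInterval_of_forall_pos hφ ha hab).sub_le_of_hasDerivAt_le hab ?_
  have hsub : Set.Ioo a b ⊆ Set.Ioi 0 := fun t ht => ha.trans_lt ht.1
  filter_upwards [ae_restrict_of_ae_restrict_of_subset hsub hd,
    ae_restrict_mem measurableSet_Ioo] with t h1 h2 using h1 h2

theorem abs_sub_le_of_ae_hasDerivAt (hφ : ∀ T > 0, AbsolutelyContinuousOnInterval φ 0 T)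
    {a b m : ℝ} (ha : 0 ≤ a) (hab : a ≤ b)
    (hd : ∀ᵐ t ∂(volume.restrict (Set.Ioi (0 : ℝ))), ∃ m', |m'| ≤ m ∧ HasDerivAt φ m' t) :
    |φ b - φ a| ≤ m * (b - a) := by
  have h1 := sub_le_of_ae_hasDerivAt_le hφ ha hab (m := m) (by
    filter_upwards [hd] with t ⟨m', hm', ht⟩ _ using ⟨m', (abs_le.1 hm').2, ht⟩)
  have h2 := sub_le_of_ae_hasDerivAt_le (fun T hT => (hφ T hT).neg) ha hab (m := m) (by
    filter_upwards [hd] with t ⟨m', hm', ht⟩ _ using ⟨-m', by linarith [(abs_le.1 hm').1], ht.neg⟩)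
  simp only [Pi.neg_apply] at h2
  exact abs_le.2 ⟨by linarith, h1⟩

/-- An absolutely continuous function that starts nonnegative and does not decrease while it is
nonpositive stays nonnegative. -/
theorem nonneg_of_ae_hasDerivAt_nonneg (hφ : ∀ T > 0, AbsolutelyContinuousOnInterval φ 0 T)
    (h0 : 0 ≤ φ 0) (hd : ∀ᵐ t ∂(volume.restrict (Set.Ioi (0 : ℝ))), φ t ≤ 0 →
      ∃ m ≥ 0, HasDerivAt φ m t) {t : ℝ} (ht : 0 ≤ t) : 0 ≤ φ t := by
  by_contra hneg
  push Not at hneg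
  have hcont : ContinuousOn φ (Set.Icc 0 t) :=
    (continuousOn_Ici_of_absolutelyContinuousOnInterval hφ).mono Set.Icc_subset_Ici_self
  have hcpt : IsCompact (Set.Icc 0 t ∩ φ ⁻¹' Set.Ici 0) :=
    isCompact_Icc.of_isClosed_subset (hcont.preimage_isClosed_of_isClosed isClosed_Icc isClosed_Ici)
      Set.inter_subset_left
  -- After the last nonnegative time `s` the function is negative up to `t`, hence nondecreasing,
  -- which is absurd.
  obtain ⟨s, ⟨hs, hφs⟩, hmax⟩ := hcpt.exists_isGreatest ⟨0, ⟨le_rfl, ht⟩, h0⟩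
  have := sub_le_of_ae_hasDerivAt_le (fun T hT => (hφ T hT).neg) hs.1 hs.2 (m := 0) (by
    filter_upwards [hd] with r hr hrs
    have hφr : φ r ≤ 0 := by
      by_contra hpos
      exact absurd (hmax ⟨⟨hs.1.trans hrs.1.le, hrs.2.le⟩, (not_le.1 hpos).le⟩) (not_le.2 hrs.1)
    obtain ⟨m, hm, hrm⟩ := hr hφr
    exact ⟨-m, by linarith, hrm.neg⟩)
  simp only [Pi.neg_apply] at this
  have : 0 ≤ φ s := hφs
  linarith

theorem exists_tendsto_of_antitoneOn {W : ℝ → ℝ} (hW : AntitoneOn W (Set.Ici 0))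
    (hW0 : ∀ t, 0 ≤ W t) : ∃ w, Tendsto W atTop (𝓝 w) := by
  have hanti : Antitone fun t => W (max t 0) := fun s t hst =>
    hW (Set.mem_Ici.2 (le_max_right _ _)) (Set.mem_Ici.2 (le_max_right _ _)) (max_le_max_right _ hst)
  refine ⟨_, (tendsto_atTop_ciInf hanti ⟨0, ?_⟩).congr' ?_⟩
  · rintro _ ⟨t, rfl⟩
    exact hW0 _
  · filter_upwards [eventually_ge_atTop 0] with t ht
    rw [max_eq_left ht]

end HalfLine

/-! ### Projected dynamics and the Lyapunov function -/

namespace OverlayNetwork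

theorem abs_posProj_le (b a : ℝ) : |posProj b a| ≤ |b| := by
  unfold posProj
  split_ifs
  · rw [abs_of_nonneg (le_max_left _ _)]
    exact max_le (abs_nonneg _) (le_abs_self _)
  · exact le_rfl

theorem le_posProj (b a : ℝ) : b ≤ posProj b a := by
  unfold posProj
  split_ifs
  exacts [le_max_right _ _, le_rfl]

theorem posProj_of_pos {a : ℝ} (b : ℝ) (ha : 0 < a) : posProj b a = b := by
  rw [posProj, if_neg (not_le.2 ha)]

theorem posProj_nonneg {a : ℝ} (b : ℝ) (ha : a ≤ 0) : 0 ≤ posProj b a := by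
  rw [posProj, if_pos ha]
  exact le_max_left _ _

/-- The projection can only raise `b`, and does so only at `a = 0`, where `a - a' ≤ 0`. It therefore
never hurts the Lyapunov estimate. -/
theorem sub_mul_posProj_le {a a' : ℝ} (b : ℝ) (ha : 0 ≤ a) (ha' : 0 ≤ a') :
    (a - a') * posProj b a ≤ (a - a') * b := by
  rcases ha.eq_or_lt with rfl | ha
  · exact mul_le_mul_of_nonpos_left (le_posProj b 0) (by linarith)
  · rw [posProj_of_pos b ha]

variable {V : Type*} [Fintype V] {N : OverlayNetwork V}

/-- The weighted squared distance of the state to a reference point. -/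
noncomputable def lyapunov (N : OverlayNetwork V) (α : ℝ) (k : V → N.Receiver → ℝ)
    (x₀ x : ℝ × N.Multipliers) : ℝ :=
  (2 * α)⁻¹ * (x.1 - x₀.1) ^ 2 +
    ∑ v : V, ∑ d : N.Receiver, (2 * k v d)⁻¹ * (x.2 v d - x₀.2 v d) ^ 2

section Lyapunov

variable {α : ℝ} {k : V → N.Receiver → ℝ}

theorem lyapunov_nonneg (hα : 0 < α) (hk : ∀ v d, 0 < k v d) (x₀ x : ℝ × N.Multipliers) :
    0 ≤ N.lyapunov α k x₀ x :=
  add_nonneg (mul_nonneg (by positivity) (sq_nonneg _)) <|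
    Finset.sum_nonneg fun v _ => Finset.sum_nonneg fun d _ =>
      mul_nonneg (inv_nonneg.2 (by linarith [hk v d])) (sq_nonneg _)

theorem broadcast_sq_le_lyapunov (hα : 0 < α) (hk : ∀ v d, 0 < k v d)
    (x₀ x : ℝ × N.Multipliers) :
    (x.1 - x₀.1) ^ 2 ≤ 2 * α * N.lyapunov α k x₀ x := by
  have h : (2 * α)⁻¹ * (x.1 - x₀.1) ^ 2 ≤ N.lyapunov α k x₀ x :=
    le_add_of_nonneg_right <| Finset.sum_nonneg fun v _ => Finset.sum_nonneg fun d _ =>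
      mul_nonneg (inv_nonneg.2 (by linarith [hk v d])) (sq_nonneg _)
  rwa [inv_mul_le_iff₀ (by positivity)] at h

theorem multiplier_sq_le_lyapunov (hα : 0 < α) (hk : ∀ v d, 0 < k v d)
    (x₀ x : ℝ × N.Multipliers) (v : V) (d : N.Receiver) :
    (x.2 v d - x₀.2 v d) ^ 2 ≤ 2 * k v d * N.lyapunov α k x₀ x := by
  have hnn : ∀ v d, 0 ≤ (2 * k v d)⁻¹ * (x.2 v d - x₀.2 v d) ^ 2 := fun v d =>
    mul_nonneg (inv_nonneg.2 (by linarith [hk v d])) (sq_nonneg _)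
  have h : (2 * k v d)⁻¹ * (x.2 v d - x₀.2 v d) ^ 2 ≤ N.lyapunov α k x₀ x :=
    calc _ ≤ ∑ d : N.Receiver, (2 * k v d)⁻¹ * (x.2 v d - x₀.2 v d) ^ 2 :=
          Finset.single_le_sum (fun d _ => hnn v d) (Finset.mem_univ d)
      _ ≤ ∑ v : V, ∑ d : N.Receiver, (2 * k v d)⁻¹ * (x.2 v d - x₀.2 v d) ^ 2 :=
          Finset.single_le_sum (f := fun v => ∑ d : N.Receiver,
            (2 * k v d)⁻¹ * (x.2 v d - x₀.2 v d) ^ 2)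
            (fun v _ => Finset.sum_nonneg fun d _ => hnn v d) (Finset.mem_univ v)
      _ ≤ _ := le_add_of_nonneg_left (mul_nonneg (by positivity) (sq_nonneg _))
  have := hk v d
  rwa [inv_mul_le_iff₀ (by positivity)] at h

theorem continuous_lyapunov (x₀ : ℝ × N.Multipliers) : Continuous (N.lyapunov α k x₀) := by
  unfold lyapunov
  fun_prop

theorem lyapunov_self (x₀ : ℝ × N.Multipliers) : N.lyapunov α k x₀ x₀ = 0 := by
  simp [lyapunov]

theorem exists_closedBall_of_lyapunov_antitoneOn (hα : 0 < α) (hk : ∀ v d, 0 < k v d)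
    {z : ℝ → ℝ} {lam : ℝ → N.Multipliers} {x₀ : ℝ × N.Multipliers}
    (hanti : AntitoneOn (fun t => N.lyapunov α k x₀ (z t, lam t)) (Set.Ici 0)) :
    ∃ R : ℝ, ∀ t, 0 ≤ t → (z t, lam t) ∈ Metric.closedBall x₀ R := by
  set V₀ := N.lyapunov α k x₀ (z 0, lam 0)
  have hV₀ : 0 ≤ V₀ := lyapunov_nonneg hα hk _ _
  set K := ∑ v : V, ∑ d : N.Receiver, k v d
  have hK : ∀ v d, k v d ≤ K := fun v d =>
    (Finset.single_le_sum (fun d _ => (hk v d).le) (Finset.mem_univ d)).trans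
      (Finset.single_le_sum (f := fun v => ∑ d : N.Receiver, k v d)
        (fun v _ => Finset.sum_nonneg fun d _ => (hk v d).le) (Finset.mem_univ v))
  have hK0 : 0 ≤ K := Finset.sum_nonneg fun v _ => Finset.sum_nonneg fun d _ => (hk v d).le
  refine ⟨√(2 * (α + K) * V₀), fun t ht => ?_⟩
  have hVt : N.lyapunov α k x₀ (z t, lam t) ≤ V₀ := hanti (Set.mem_Ici.2 le_rfl) ht ht
  rw [Metric.mem_closedBall, Prod.dist_eq, max_le_iff]
  constructor
  · rw [Real.dist_eq]
    refine Real.abs_le_sqrt ((broadcast_sq_le_lyapunov hα hk x₀ (z t, lam t)).trans ?_)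
    exact mul_le_mul (by linarith) hVt (lyapunov_nonneg hα hk _ _) (by positivity)
  · refine (dist_pi_le_iff (Real.sqrt_nonneg _)).2 fun v =>
      (dist_pi_le_iff (Real.sqrt_nonneg _)).2 fun d => ?_
    rw [Real.dist_eq]
    refine Real.abs_le_sqrt ((multiplier_sq_le_lyapunov hα hk x₀ (z t, lam t) v d).trans ?_)
    exact mul_le_mul (by linarith [hK v d]) hVt (lyapunov_nonneg hα hk _ _) (by positivity)

end Lyapunov

/-! ### Dissipation along trajectories and conditions at cluster points -/

namespace IsTrajectory

variable {U : ℝ → ℝ} {α : ℝ} {k : V → N.Receiver → ℝ} {z : ℝ → ℝ} {lam : ℝ → N.Multipliers}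
  {f : ℝ → N.Flows} {g : ℝ → N.Rates}

theorem broadcast_nonneg (h : N.IsTrajectory U α k z lam f g) (hα : 0 < α) {t : ℝ} (ht : 0 ≤ t) :
    0 ≤ z t := by
  refine nonneg_of_ae_hasDerivAt_nonneg h.ac_broadcast h.init_broadcast ?_ ht
  filter_upwards [h.broadcast_ode] with s hs hzs
  exact ⟨_, mul_nonneg hα.le (posProj_nonneg _ hzs), hs⟩

open Classical in
theorem ae_hasDerivAt_multiplier (h : N.IsTrajectory U α k z lam f g) :
    ∀ᵐ t ∂(volume.restrict (Set.Ioi (0 : ℝ))), ∀ (v : V) (d : N.Receiver),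
      HasDerivAt (fun τ => lam τ v d) (if v = d.1 then 0 else
        k v d * posProj (N.excess (z t) (f t) v d) (lam t v d)) t := by
  filter_upwards [h.multiplier_ode, ae_restrict_mem measurableSet_Ioi] with t ht ht0 v d
  split_ifs with hv
  · subst hv
    refine (hasDerivAt_const t (0 : ℝ)).congr_of_eventuallyEq ?_
    filter_upwards [lt_mem_nhds (Set.mem_Ioi.1 ht0)] with s hs
    exact h.multiplier_dest s hs.le d
  · exact ht v d hv

theorem multiplier_mem (h : N.IsTrajectory U α k z lam f g) (hk : ∀ v d, 0 < k v d) {t : ℝ}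
    (ht : 0 ≤ t) : lam t ∈ N.multiplierSet := by
  classical
  refine ⟨fun v d => ?_, h.multiplier_dest t ht⟩
  refine nonneg_of_ae_hasDerivAt_nonneg (φ := fun t => lam t v d) (h.ac_multiplier v d)
    (h.init_multiplier v d) ?_ ht
  filter_upwards [h.ae_hasDerivAt_multiplier] with s hs hls
  refine ⟨_, ?_, hs v d⟩
  split_ifs
  exacts [le_rfl, mul_nonneg (hk v d).le (posProj_nonneg _ hls)]

theorem ac_lyapunov (h : N.IsTrajectory U α k z lam f g) (x₀ : ℝ × N.Multipliers) {T : ℝ}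
    (hT : 0 < T) :
    AbsolutelyContinuousOnInterval (fun t => N.lyapunov α k x₀ (z t, lam t)) 0 T := by
  have hconst : ∀ c : ℝ, AbsolutelyContinuousOnInterval (fun _ => c) 0 T := fun c =>
    (LipschitzWith.const c).lipschitzOnWith.absolutelyContinuousOnInterval
  have hsq : ∀ (φ : ℝ → ℝ) (a c : ℝ), AbsolutelyContinuousOnInterval φ 0 T →
      AbsolutelyContinuousOnInterval (fun t => a * (φ t - c) ^ 2) 0 T := fun φ a c hφ => by
    simp only [pow_two]
    exact ((hφ.fun_sub (hconst c)).fun_mul (hφ.fun_sub (hconst c))).const_mul a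
  have hsum : ∀ {ι : Type _} (s : Finset ι) (F : ι → ℝ → ℝ),
      (∀ i ∈ s, AbsolutelyContinuousOnInterval (F i) 0 T) →
      AbsolutelyContinuousOnInterval (fun t => ∑ i ∈ s, F i t) 0 T := by
    classical
    intro ι s F hF
    induction s using Finset.induction_on with
    | empty => simpa using hconst 0
    | insert j s hj ih =>
      simp only [Finset.sum_insert hj]
      exact (hF j (Finset.mem_insert_self _ _)).fun_add
        (ih fun i hi => hF i (Finset.mem_insert_of_mem hi))
  exact (hsq z _ _ (h.ac_broadcast T hT)).fun_add
    (hsum _ _ fun v _ => hsum _ _ fun d _ => hsq _ _ _ (h.ac_multiplier v d T hT))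

/-- The Lyapunov function decreases at least at the rate given by the gap of the tangent
inequality and the complementarity gap. -/
theorem ae_hasDerivAt_lyapunov (h : N.IsTrajectory U α k z lam f g) (hα : 0 < α)
    (hk : ∀ v d, 0 < k v d) {zopt : ℝ} (hzopt : 0 ≤ zopt) {lamopt : N.Multipliers}
    (hopt : N.IsDualOptimal U zopt lamopt) {q : N.Flows × N.Rates} (hq : q ∈ N.scheduleSet) :
    ∀ᵐ t ∂(volume.restrict (Set.Ioi (0 : ℝ))),
      ∃ m ≤ -(U (z t) + derivWithin U (Set.Ici 0) (z t) * (zopt - z t) - U zopt)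
          + N.weightedExcess (lam t) zopt q.1,
        HasDerivAt (fun τ => N.lyapunov α k (zopt, lamopt) (z τ, lam τ)) m t := by
  classical
  filter_upwards [h.broadcast_ode, h.ae_hasDerivAt_multiplier, h.scheduling,
    ae_restrict_mem measurableSet_Ioi] with t hz hlam hfg ht
  have hz0 := h.broadcast_nonneg hα (le_of_lt ht)
  have hl0 := h.multiplier_mem hk (le_of_lt ht)
  obtain ⟨hsched, hmax⟩ := schedulable_and_weightedExcess_le_of_mem_fluidDecisions hfg
  set σ := ∑ d, lam t N.source d with hσ
  set b := derivWithin U (Set.Ici 0) (z t) - σ with hb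
  refine ⟨(z t - zopt) * posProj b (z t) + ∑ v : V, ∑ d : N.Receiver, (lam t v d - lamopt v d) *
    (if v = d.1 then 0 else posProj (N.excess (z t) (f t) v d) (lam t v d)), ?_, ?_⟩
  -- The `σ` terms of the rate and queue equations cancel. Scheduler optimality replaces the current
  -- flow by `q`, and dual optimality bounds the reference term by `U zopt - U (z t)`.
  · have h1 := sub_mul_posProj_le b hz0 hzopt
    have h2 : ∑ v : V, ∑ d : N.Receiver, (lam t v d - lamopt v d) *
        (if v = d.1 then 0 else posProj (N.excess (z t) (f t) v d) (lam t v d))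
        ≤ N.weightedExcess (lam t - lamopt) (z t) (f t) := by
      refine Finset.sum_le_sum fun v _ => Finset.sum_le_sum fun d _ => ?_
      simp only [Pi.sub_apply]
      split_ifs with hv
      · rw [hv, hl0.2 d, hopt.mem_multiplierSet.2 d]
        simp
      · exact sub_mul_posProj_le _ (hl0.1 v d) (hopt.mem_multiplierSet.1 v d)
    rw [weightedExcess_sub] at h2
    have h3 := hopt.lagrangian_le (z t) hz0 _ hsched
    rw [lagrangian_eq] at h3
    have h4 := N.weightedExcess_eq (lam t) (z t) (f t)
    have h5 := N.weightedExcess_eq (lam t) zopt q.1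
    have h6 := hmax q hq
    rw [← hσ] at h4 h5
    simp only at h3 h6
    have h7 : (z t - zopt) * b = -(derivWithin U (Set.Ici 0) (z t) * (zopt - z t))
        - z t * σ + zopt * σ := by rw [hb]; ring
    linarith
  · refine HasDerivAt.add ?_ (HasDerivAt.fun_sum fun v _ => HasDerivAt.fun_sum fun d _ => ?_)
    · have h1 := ((hz.sub_const zopt).pow 2).const_mul (2 * α)⁻¹
      refine h1.congr_deriv ?_
      simp only [Nat.cast_ofNat, Nat.add_one_sub_one, pow_one]
      field_simp
    · have h1 := (((hlam v d).sub_const (lamopt v d)).pow 2).const_mul (2 * k v d)⁻¹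
      refine h1.congr_deriv ?_
      have := (hk v d).ne'
      simp only [Nat.cast_ofNat, Nat.add_one_sub_one, pow_one]
      split_ifs
      · simp
      · field_simp

theorem lyapunov_antitoneOn (h : N.IsTrajectory U α k z lam f g) (hα : 0 < α)
    (hk : ∀ v d, 0 < k v d) (hU : StrictConcaveOn ℝ (Set.Ici 0) U)
    (hU1 : DifferentiableOn ℝ U (Set.Ici 0)) {x : ℝ × N.Flows × N.Rates}
    (hx : N.Feasible x) {lamopt : N.Multipliers} (hopt : N.IsDualOptimal U x.1 lamopt) :
    AntitoneOn (fun t => N.lyapunov α k (x.1, lamopt) (z t, lam t)) (Set.Ici 0) := by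
  intro a ha b hb hab
  have := sub_le_of_ae_hasDerivAt_le (fun T hT => h.ac_lyapunov (x.1, lamopt) hT) ha hab
    (m := 0) (by
      filter_upwards [h.ae_hasDerivAt_lyapunov hα hk hx.broadcast_nonneg hopt hx.schedulable,
        ae_restrict_mem measurableSet_Ioi] with t ⟨m, hm, hd⟩ ht _
      refine ⟨m, hm.trans ?_, hd⟩
      have h1 := hU.le_tangent hU1 (h.broadcast_nonneg hα (le_of_lt ht)) hx.broadcast_nonneg
      have h2 := weightedExcess_nonpos hx (h.multiplier_mem hk (le_of_lt ht))
      linarith)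
  dsimp only at this ⊢
  linarith

/-- The state remains in a compact set and decisions in the schedule polytope, so the velocities are
bounded although the scheduler is discontinuous. -/
theorem exists_lipschitz (h : N.IsTrajectory U α k z lam f g) (hα : 0 < α)
    (hk : ∀ v d, 0 < k v d) (hU' : ContinuousOn (derivWithin U (Set.Ici 0)) (Set.Ici 0))
    {x₀ : ℝ × N.Multipliers} {R : ℝ} (hR : ∀ t, 0 ≤ t → (z t, lam t) ∈ Metric.closedBall x₀ R) :
    ∃ L : ℝ, ∀ s t, 0 ≤ s → s ≤ t → dist (z t, lam t) (z s, lam s) ≤ L * (t - s) := by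
  classical
  let D : Set (ℝ × N.Multipliers) := Metric.closedBall x₀ R ∩ {x | 0 ≤ x.1}
  have hD : IsCompact D := (isCompact_closedBall x₀ R).inter_right
    (isClosed_le continuous_const continuous_fst)
  have hmem : ∀ t, 0 ≤ t → (z t, lam t) ∈ D := fun t ht => ⟨hR t ht, h.broadcast_nonneg hα ht⟩
  obtain ⟨B₁, hB₁⟩ := hD.exists_bound_of_continuousOn
    (f := fun x => derivWithin U (Set.Ici 0) x.1 - ∑ d, x.2 N.source d)
    ((hU'.comp continuousOn_fst fun x hx => hx.2).sub (Continuous.continuousOn (by fun_prop)))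
  have hB₂ : ∀ v d, ∃ B, ∀ y ∈ D ×ˢ N.scheduleSet, ‖N.excess y.1.1 y.2.1 v d‖ ≤ B := fun v d =>
    (hD.prod N.isCompact_scheduleSet).exists_bound_of_continuousOn
      ((N.continuous_excess v d).comp
        (f := fun y : (ℝ × N.Multipliers) × N.Flows × N.Rates => (y.1.1, y.2.1))
        (by fun_prop)).continuousOn
  choose B₂ hB₂ using hB₂
  have hB₂0 : ∀ v d, 0 ≤ B₂ v d := fun v d =>
    (norm_nonneg _).trans (hB₂ v d ((z 0, lam 0), 0) ⟨hmem 0 le_rfl, N.zero_mem_scheduleSet⟩)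
  have hB₁0 : 0 ≤ B₁ := (norm_nonneg _).trans (hB₁ _ (hmem 0 le_rfl))
  have hKB : ∀ v d, 0 ≤ k v d * B₂ v d := fun v d => mul_nonneg (hk v d).le (hB₂0 v d)
  set K := ∑ v : V, ∑ d : N.Receiver, k v d * B₂ v d
  have hK : ∀ v d, k v d * B₂ v d ≤ K := fun v d =>
    (Finset.single_le_sum (fun d _ => hKB v d) (Finset.mem_univ d)).trans
      (Finset.single_le_sum (f := fun v => ∑ d : N.Receiver, k v d * B₂ v d)
        (fun v _ => Finset.sum_nonneg fun d _ => hKB v d) (Finset.mem_univ v))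
  have hK0 : 0 ≤ K := Finset.sum_nonneg fun v _ => Finset.sum_nonneg fun d _ => hKB v d
  refine ⟨α * B₁ + K, fun s t hs hst => ?_⟩
  have hts : 0 ≤ t - s := sub_nonneg.2 hst
  rw [Prod.dist_eq, max_le_iff]
  constructor
  · rw [Real.dist_eq]
    refine abs_sub_le_of_ae_hasDerivAt h.ac_broadcast hs hst ?_
    filter_upwards [h.broadcast_ode, ae_restrict_mem measurableSet_Ioi] with r hr hr0
    refine ⟨_, ?_, hr⟩
    rw [abs_mul, abs_of_pos hα]
    have := (abs_posProj_le _ (z r)).trans (hB₁ _ (hmem r (le_of_lt hr0)))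
    simp only at this
    nlinarith
  · refine (dist_pi_le_iff (by positivity)).2 fun v => (dist_pi_le_iff (by positivity)).2
      fun d => ?_
    rw [Real.dist_eq]
    refine abs_sub_le_of_ae_hasDerivAt (φ := fun t => lam t v d) (h.ac_multiplier v d) hs hst ?_
    filter_upwards [h.ae_hasDerivAt_multiplier, h.scheduling,
      ae_restrict_mem measurableSet_Ioi] with r hr hfg hr0
    refine ⟨_, ?_, hr v d⟩
    have hαB : 0 ≤ α * B₁ := by positivity
    split_ifs
    · rw [abs_zero]
      linarith
    · rw [abs_mul, abs_of_pos (hk v d)]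
      have := (abs_posProj_le _ (lam r v d)).trans (hB₂ v d ((z r, lam r), f r, g r)
        ⟨hmem r (le_of_lt hr0), (schedulable_and_weightedExcess_le_of_mem_fluidDecisions hfg).1⟩)
      have := mul_le_mul_of_nonneg_left this (hk v d).le
      simp only at this
      linarith [hK v d]

/-- Along a trajectory that clusters at `x`, the Lyapunov dissipation vanishes at `x`. -/
theorem tangent_gap_le_weightedExcess (h : N.IsTrajectory U α k z lam f g) (hα : 0 < α)
    (hk : ∀ v d, 0 < k v d) (hU1 : DifferentiableOn ℝ U (Set.Ici 0))
    (hU' : ContinuousOn (derivWithin U (Set.Ici 0)) (Set.Ici 0)) {zopt : ℝ} (hzopt : 0 ≤ zopt)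
    {lamopt : N.Multipliers} (hopt : N.IsDualOptimal U zopt lamopt)
    (hanti : AntitoneOn (fun t => N.lyapunov α k (zopt, lamopt) (z t, lam t)) (Set.Ici 0))
    {L : ℝ} (hL : ∀ s t, 0 ≤ s → s ≤ t → dist (z t, lam t) (z s, lam s) ≤ L * (t - s))
    {x : ℝ × N.Multipliers} (hx : MapClusterPt x atTop fun t => (z t, lam t)) (hx0 : 0 ≤ x.1)
    {q : N.Flows × N.Rates} (hq : q ∈ N.scheduleSet) :
    U x.1 + derivWithin U (Set.Ici 0) x.1 * (zopt - x.1) - U zopt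
      ≤ N.weightedExcess x.2 zopt q.1 := by
  by_contra hlt
  -- For fixed `q` this lower bound on the dissipation is continuous in the state. If positive at
  -- `x`, it exceeds `Q x / 2` nearby and the Lyapunov function would drop on every visit.
  let Q : ℝ × N.Multipliers → ℝ := fun y =>
    U y.1 + derivWithin U (Set.Ici 0) y.1 * (zopt - y.1) - U zopt - N.weightedExcess y.2 zopt q.1
  have hQ : ContinuousOn Q {y | 0 ≤ y.1} := by
    have hm : Set.MapsTo Prod.fst {y : ℝ × N.Multipliers | 0 ≤ y.1} (Set.Ici 0) := fun y hy => hy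
    refine (((hU1.continuousOn.comp continuousOn_fst hm).add ((hU'.comp continuousOn_fst hm).mul
      (Continuous.continuousOn (by fun_prop)))).sub continuousOn_const).sub
      (Continuous.continuousOn ?_)
    exact N.continuous_weightedExcess.comp
      (f := fun y : ℝ × N.Multipliers => (y.2, zopt, q.1)) (by fun_prop)
  have hQx : 0 < Q x := by simp only [Q]; linarith
  obtain ⟨w, hw⟩ := exists_tendsto_of_antitoneOn hanti fun t => lyapunov_nonneg hα hk _ _
  have hO := eventually_nhdsWithin_iff.1 ((hQ x hx0).eventually (lt_mem_nhds (half_lt_self hQx)))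
  refine not_mapClusterPt_of_descent hL hw hO (half_pos hQx) (fun a b ha hab hO => ?_) hx
  refine sub_le_of_ae_hasDerivAt_le (fun T hT => h.ac_lyapunov (zopt, lamopt) hT) ha hab ?_
  filter_upwards [h.ae_hasDerivAt_lyapunov hα hk hzopt hopt hq] with t ⟨m, hm, hd⟩ ht
  refine ⟨m, hm.trans ?_, hd⟩
  have := hO t ⟨ht.1.le, ht.2.le⟩ (h.broadcast_nonneg hα (ha.trans ht.1.le))
  simp only [Q] at this ⊢
  linarith

/-- If marginal utility exceeded the price at a cluster point, `z` would grow at a definite rate on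
every visit, projected or not, against its convergence. -/
theorem marginal_le_price (h : N.IsTrajectory U α k z lam f g) (hα : 0 < α)
    (hU' : ContinuousOn (derivWithin U (Set.Ici 0)) (Set.Ici 0))
    {L : ℝ} (hL : ∀ s t, 0 ≤ s → s ≤ t → dist (z t, lam t) (z s, lam s) ≤ L * (t - s))
    {x : ℝ × N.Multipliers} (hx : MapClusterPt x atTop fun t => (z t, lam t)) (hx0 : 0 ≤ x.1)
    (hz : Tendsto z atTop (𝓝 x.1)) :
    derivWithin U (Set.Ici 0) x.1 ≤ ∑ d, x.2 N.source d := by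
  by_contra hlt
  let Q : ℝ × N.Multipliers → ℝ := fun y => derivWithin U (Set.Ici 0) y.1 - ∑ d, y.2 N.source d
  have hQ : ContinuousOn Q {y | 0 ≤ y.1} :=
    (hU'.comp continuousOn_fst fun y hy => hy).sub (Continuous.continuousOn (by fun_prop))
  have hQx : 0 < Q x := by simp only [Q]; linarith
  have hO := eventually_nhdsWithin_iff.1 ((hQ x hx0).eventually (lt_mem_nhds (half_lt_self hQx)))
  refine not_mapClusterPt_of_descent hL hz.neg hO (mul_pos hα (half_pos hQx))
    (fun a b ha hab hO => ?_) hx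
  refine sub_le_of_ae_hasDerivAt_le (fun T hT => (h.ac_broadcast T hT).fun_neg) ha hab ?_
  filter_upwards [h.broadcast_ode] with t hd ht
  refine ⟨_, ?_, hd.neg⟩
  have h1 := hO t ⟨ht.1.le, ht.2.le⟩ (h.broadcast_nonneg hα (ha.trans ht.1.le))
  rw [neg_le_neg_iff]
  exact mul_le_mul_of_nonneg_left (h1.le.trans (le_posProj _ _)) hα.le

/-- The reverse inequality needs a positive limit rate, so that the projection is inactive near the
cluster point. -/
theorem price_le_marginal (h : N.IsTrajectory U α k z lam f g) (hα : 0 < α)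
    (hU' : ContinuousOn (derivWithin U (Set.Ici 0)) (Set.Ici 0))
    {L : ℝ} (hL : ∀ s t, 0 ≤ s → s ≤ t → dist (z t, lam t) (z s, lam s) ≤ L * (t - s))
    {x : ℝ × N.Multipliers} (hx : MapClusterPt x atTop fun t => (z t, lam t)) (hx0 : 0 < x.1)
    (hz : Tendsto z atTop (𝓝 x.1)) :
    ∑ d, x.2 N.source d ≤ derivWithin U (Set.Ici 0) x.1 := by
  by_contra hlt
  let Q : ℝ × N.Multipliers → ℝ := fun y => ∑ d, y.2 N.source d - derivWithin U (Set.Ici 0) y.1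
  have hQ : ContinuousOn Q {y | 0 ≤ y.1} :=
    (Continuous.continuousOn (by fun_prop)).sub (hU'.comp continuousOn_fst fun y hy => hy)
  have hQx : 0 < Q x := by simp only [Q]; linarith
  have hO := (eventually_nhdsWithin_iff.1
    ((hQ x hx0.le).eventually (lt_mem_nhds (half_lt_self hQx)))).and
    (continuous_fst.continuousAt.eventually (lt_mem_nhds hx0))
  refine not_mapClusterPt_of_descent hL hz hO (mul_pos hα (half_pos hQx))
    (fun a b ha hab hO => ?_) hx
  refine sub_le_of_ae_hasDerivAt_le h.ac_broadcast ha hab ?_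
  filter_upwards [h.broadcast_ode] with t hd ht
  refine ⟨_, ?_, hd⟩
  obtain ⟨h1, h2⟩ := hO t ⟨ht.1.le, ht.2.le⟩
  have h3 := h1 h2.le
  rw [posProj_of_pos _ h2, ← mul_neg]
  refine mul_le_mul_of_nonneg_left ?_ hα.le
  simp only [Q] at h3 ⊢
  linarith

end IsTrajectory

end OverlayNetwork

theorem intervalIntegrable_finsetSum {ι : Type*} (s : Finset ι) {F : ι → ℝ → ℝ} {a b : ℝ}
    (hF : ∀ i ∈ s, IntervalIntegrable (F i) volume a b) :
    IntervalIntegrable (fun t => ∑ i ∈ s, F i t) volume a b := by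
  simpa only [Finset.sum_fn] using IntervalIntegrable.sum s hF

/-! ### Convergence of the state -/

namespace OverlayNetwork

theorem isClosed_multiplierSet {V : Type*} {N : OverlayNetwork V} :
    IsClosed N.multiplierSet := by
  have : N.multiplierSet = (⋂ v, ⋂ d, {lam | 0 ≤ lam v d}) ∩ ⋂ d : N.Receiver,
      {lam | lam d.1 d = 0} := by
    ext lam
    simp [multiplierSet]
  rw [this]
  exact (isClosed_iInter fun v => isClosed_iInter fun d =>
    isClosed_le continuous_const (by fun_prop)).inter
    (isClosed_iInter fun d => isClosed_eq (by fun_prop) continuous_const)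

variable {V : Type*} [Fintype V] {N : OverlayNetwork V}

namespace IsTrajectory

variable {U : ℝ → ℝ} {α : ℝ} {k : V → N.Receiver → ℝ} {z : ℝ → ℝ} {lam : ℝ → N.Multipliers}
  {f : ℝ → N.Flows} {g : ℝ → N.Rates}

/-- The state of the algorithm converges to an optimal rate and dual optimal multipliers. -/
theorem tendsto_state (h : N.IsTrajectory U α k z lam f g) (hα : 0 < α)
    (hk : ∀ v d, 0 < k v d) (hU : StrictConcaveOn ℝ (Set.Ici 0) U)
    (hU1 : DifferentiableOn ℝ U (Set.Ici 0))
    (hU' : ContinuousOn (derivWithin U (Set.Ici 0)) (Set.Ici 0))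
    {x : ℝ × N.Flows × N.Rates} (hx : x ∈ N.optimalSet U) :
    Tendsto z atTop (𝓝 x.1) ∧
      ∃ lamopt, N.IsDualOptimal U x.1 lamopt ∧ Tendsto lam atTop (𝓝 lamopt) := by
  obtain ⟨lam₀, hlam₀⟩ := exists_isDualOptimal hU hU1 hx
  have hx0 := hx.1.broadcast_nonneg
  have hanti := h.lyapunov_antitoneOn hα hk hU hU1 hx.1 hlam₀
  obtain ⟨R, hR⟩ := exists_closedBall_of_lyapunov_antitoneOn hα hk hanti
  obtain ⟨L, hL⟩ := h.exists_lipschitz hα hk hU' hR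
  let D : Set (ℝ × N.Multipliers) := Metric.closedBall (x.1, lam₀) R ∩
    ({y | 0 ≤ y.1} ∩ Prod.snd ⁻¹' N.multiplierSet)
  have hD : IsCompact D := (isCompact_closedBall _ R).inter_right
    ((isClosed_le continuous_const continuous_fst).inter
      (isClosed_multiplierSet.preimage continuous_snd))
  have hmem : ∀ᶠ t in atTop, (z t, lam t) ∈ D := by
    filter_upwards [eventually_ge_atTop 0] with t ht
    exact ⟨hR t ht, h.broadcast_nonneg hα ht, h.multiplier_mem hk ht⟩
  -- Every ultrafilter limit has the optimal rate: otherwise strict concavity makes the tangent gap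
  -- positive, while an optimal schedule has nonpositive weighted excess.
  have hlim : ∀ 𝒰 : Ultrafilter ℝ, ↑𝒰 ≤ (atTop : Filter ℝ) → ∃ y ∈ D,
      Tendsto (fun t => (z t, lam t)) 𝒰 (𝓝 y) ∧ y.1 = x.1 ∧
      ∀ q ∈ N.scheduleSet, 0 ≤ N.weightedExcess y.2 x.1 q.1 := by
    intro 𝒰 h𝒰
    obtain ⟨y, hy, hty⟩ := hD.ultrafilter_le_nhds' (𝒰.map fun t => (z t, lam t)) (h𝒰 hmem)
    have hcl : MapClusterPt y atTop fun t => (z t, lam t) :=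
      mapClusterPt_iff_ultrafilter.2 ⟨𝒰, h𝒰, hty⟩
    have hgap := fun q (hq : q ∈ N.scheduleSet) =>
      h.tangent_gap_le_weightedExcess hα hk hU1 hU' hx0 hlam₀ hanti hL hcl hy.2.1 hq
    have hyx : y.1 = x.1 := by
      by_contra hne
      have h1 := hU.lt_tangent hU1 hy.2.1 hx0 (Ne.symm hne)
      have h2 := hgap x.2 hx.1.schedulable
      have h3 := weightedExcess_nonpos hx.1 hy.2.2
      linarith
    refine ⟨y, hy, hty, hyx, fun q hq => ?_⟩
    have := hgap q hq
    rw [hyx] at this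
    linarith
  have hz : Tendsto z atTop (𝓝 x.1) := by
    rw [tendsto_iff_ultrafilter]
    intro 𝒰 h𝒰
    obtain ⟨y, -, hty, hyx, -⟩ := hlim 𝒰 h𝒰
    rw [← hyx]
    exact (continuous_fst.tendsto y).comp hty
  refine ⟨hz, ?_⟩
  obtain ⟨y, hy, hty, hyx, hq⟩ := hlim (Ultrafilter.of atTop) (Ultrafilter.of_le _)
  have hcl : MapClusterPt y atTop fun t => (z t, lam t) :=
    mapClusterPt_iff_ultrafilter.2 ⟨_, Ultrafilter.of_le _, hty⟩
  -- Tangent inequality, nonnegative weighted excess and stationarity in the rate add up to dual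
  -- optimality. At rate zero one inequality suffices because `w ≥ 0`.
  have hopt : N.IsDualOptimal U x.1 y.2 := by
    refine ⟨hy.2.2, fun w hw p hp => ?_⟩
    have h1 := hU.le_tangent hU1 hx0 hw
    have h2 := hq p hp
    rw [lagrangian_eq]
    rw [weightedExcess_eq] at h2 ⊢
    have h3 := h.marginal_le_price hα hU' hL hcl hy.2.1 (by rwa [hyx])
    have h4 : (derivWithin U (Set.Ici 0) x.1 - ∑ d, y.2 N.source d) * (w - x.1) ≤ 0 := by
      rw [hyx] at h3
      rcases hx0.eq_or_lt with h0 | h0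
      · exact mul_nonpos_of_nonpos_of_nonneg (by linarith) (by linarith)
      · have h5 := h.price_le_marginal hα hU' hL hcl (by rwa [hyx]) (by rwa [hyx])
        rw [hyx] at h5
        rw [le_antisymm h3 h5, sub_self, zero_mul]
    nlinarith
  refine ⟨y.2, hopt, ?_⟩
  -- The Lyapunov function is re-centred at the cluster point, now known to be dual optimal. It
  -- converges and tends to zero along the ultrafilter, hence tends to zero.
  have hanti' := h.lyapunov_antitoneOn hα hk hU hU1 hx.1 hopt
  obtain ⟨w, hw⟩ := exists_tendsto_of_antitoneOn hanti' fun t => lyapunov_nonneg hα hk _ _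
  have hw0 : w = 0 := by
    have h1 := hw.mono_left (Ultrafilter.of_le _)
    have h2 := ((continuous_lyapunov (α := α) (k := k) (x.1, y.2)).tendsto y).comp hty
    rw [← hyx, Prod.mk.eta, lyapunov_self] at h2
    rw [← hyx, Prod.mk.eta] at h1
    exact tendsto_nhds_unique h1 h2
  rw [hw0] at hw
  rw [tendsto_pi_nhds]
  intro v
  rw [tendsto_pi_nhds]
  intro d
  rw [tendsto_iff_dist_tendsto_zero]
  have hsq : Tendsto (fun t => √(2 * k v d * N.lyapunov α k (x.1, y.2) (z t, lam t))) atTop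
      (𝓝 0) := by
    simpa using (hw.const_mul (2 * k v d)).sqrt
  refine squeeze_zero (fun t => dist_nonneg) (fun t => ?_) hsq
  rw [Real.dist_eq]
  exact Real.abs_le_sqrt (multiplier_sq_le_lyapunov hα hk (x.1, y.2) (z t, lam t) v d)

/-! ### Time averages and primal recovery -/

theorem ae_schedulable (h : N.IsTrajectory U α k z lam f g) :
    ∀ᵐ t ∂(volume.restrict (Set.Ioi (0 : ℝ))), (f t, g t) ∈ N.scheduleSet := by
  filter_upwards [h.scheduling] with t ht
  exact (schedulable_and_weightedExcess_le_of_mem_fluidDecisions ht).1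

theorem intervalIntegrable_flow (h : N.IsTrajectory U α k z lam f g) (d : N.Receiver) (v u : V)
    {T : ℝ} (hT : 0 ≤ T) : IntervalIntegrable (fun t => f t d v u) volume 0 T := by
  rw [intervalIntegrable_iff_integrableOn_Ioc_of_le hT]
  refine Integrable.of_bound
    ((h.aemeasurable_flow d v u).mono_set Set.Ioc_subset_Ioi_self).aestronglyMeasurable
    (N.capacity v) ?_
  filter_upwards [ae_restrict_of_ae_restrict_of_subset Set.Ioc_subset_Ioi_self h.ae_schedulable]
    with t ht
  rw [Real.norm_eq_abs, abs_of_nonneg (ht.flow_nonneg d v u)]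
  exact (ht.flow_le_rate d v u).trans (ht.rate_le_capacity v u)

theorem intervalIntegrable_rate (h : N.IsTrajectory U α k z lam f g) (v u : V)
    {T : ℝ} (hT : 0 ≤ T) : IntervalIntegrable (fun t => g t v u) volume 0 T := by
  rw [intervalIntegrable_iff_integrableOn_Ioc_of_le hT]
  refine Integrable.of_bound
    ((h.aemeasurable_rate v u).mono_set Set.Ioc_subset_Ioi_self).aestronglyMeasurable
    (N.capacity v) ?_
  filter_upwards [ae_restrict_of_ae_restrict_of_subset Set.Ioc_subset_Ioi_self h.ae_schedulable]
    with t ht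
  rw [Real.norm_eq_abs, abs_of_nonneg (ht.rate_nonneg v u)]
  exact ht.rate_le_capacity v u

/-- Each scheduling constraint is linear and holds at almost every time, so it survives integration.
-/
theorem average_mem_scheduleSet (h : N.IsTrajectory U α k z lam f g) {T : ℝ} (hT : 0 < T) :
    (N.averageFlow f T, N.averageRate g T) ∈ N.scheduleSet := by
  have hT' : 0 ≤ T⁻¹ := (inv_pos.2 hT).le
  have hae : ∀ᵐ t ∂(volume.restrict (Set.Icc 0 T)), (f t, g t) ∈ N.scheduleSet := by
    rw [← Measure.restrict_congr_set Ioc_ae_eq_Icc]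
    exact ae_restrict_of_ae_restrict_of_subset Set.Ioc_subset_Ioi_self h.ae_schedulable
  have hnn : ∀ φ : ℝ → ℝ, (∀ᵐ t ∂(volume.restrict (Set.Icc 0 T)), 0 ≤ φ t) →
      0 ≤ T⁻¹ * ∫ t in (0 : ℝ)..T, φ t := fun φ hφ =>
    mul_nonneg hT' (intervalIntegral.integral_nonneg_of_ae_restrict hT.le hφ)
  have hzero : ∀ φ : ℝ → ℝ, (∀ᵐ t ∂(volume.restrict (Set.Icc 0 T)), φ t = 0) →
      T⁻¹ * ∫ t in (0 : ℝ)..T, φ t = 0 := fun φ hφ => by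
    rw [intervalIntegral.integral_of_le hT.le, ← integral_Icc_eq_integral_Ioc,
      integral_eq_zero_of_ae hφ, mul_zero]
  refine ⟨fun d v u => hnn _ ?_, fun v u => hnn _ ?_, fun d v u hvu => hzero _ ?_,
    fun v u hvu => hzero _ ?_, fun d v u hvu => ?_, fun v => ?_⟩
  · filter_upwards [hae] with t ht using ht.flow_nonneg d v u
  · filter_upwards [hae] with t ht using ht.rate_nonneg v u
  · filter_upwards [hae] with t ht using ht.flow_off_link d v u hvu
  · filter_upwards [hae] with t ht using ht.rate_off_link v u hvu
  · refine mul_le_mul_of_nonneg_left (intervalIntegral.integral_mono_ae_restrict hT.le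
      (h.intervalIntegrable_flow d v u hT.le) (h.intervalIntegrable_rate v u hT.le) ?_) hT'
    filter_upwards [hae] with t ht using ht.piggyback d v u hvu
  · simp only [averageRate]
    rw [← Finset.mul_sum, ← intervalIntegral.integral_finsetSum
      fun u _ => h.intervalIntegrable_rate v u hT.le, inv_mul_le_iff₀ hT]
    calc ∫ t in (0 : ℝ)..T, ∑ u ∈ N.outNbrs v, g t v u
        ≤ ∫ _ in (0 : ℝ)..T, N.capacity v := by
          refine intervalIntegral.integral_mono_ae_restrict hT.le ?_ intervalIntegrable_const ?_
          · exact intervalIntegrable_finsetSum _ fun u _ => h.intervalIntegrable_rate v u hT.le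
          · filter_upwards [hae] with t ht using ht.upload v
      _ = T * N.capacity v := by simp

theorem intervalIntegrable_broadcast (h : N.IsTrajectory U α k z lam f g) {a b : ℝ} (ha : 0 ≤ a)
    (hb : 0 ≤ b) : IntervalIntegrable z volume a b :=
  ((continuousOn_Ici_of_absolutelyContinuousOnInterval h.ac_broadcast).mono fun _ ht =>
    (le_min ha hb).trans ht.1).intervalIntegrable

/-- The queue at a node absorbs the accumulated excess. -/
theorem excess_average_le (h : N.IsTrajectory U α k z lam f g) (hk : ∀ v d, 0 < k v d) {T : ℝ}
    (hT : 0 < T) {v : V} {d : N.Receiver} (hv : v ≠ d.1) :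
    N.excess (T⁻¹ * ∫ t in (0 : ℝ)..T, z t) (N.averageFlow f T) v d
      ≤ T⁻¹ * ((k v d)⁻¹ * (lam T v d - lam 0 v d)) := by
  classical
  have hz := h.intervalIntegrable_broadcast le_rfl hT.le
  have hin : IntervalIntegrable (fun t => ∑ u ∈ N.inNbrs v, f t d u v) volume 0 T :=
    intervalIntegrable_finsetSum _ fun u _ => h.intervalIntegrable_flow d u v hT.le
  have hout : IntervalIntegrable (fun t => ∑ u ∈ N.outNbrs v, f t d v u) volume 0 T :=
    intervalIntegrable_finsetSum _ fun u _ => h.intervalIntegrable_flow d v u hT.le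
  have hsrc : IntervalIntegrable (fun t => if v = N.source then z t else 0) volume 0 T := by
    split_ifs
    exacts [hz, intervalIntegrable_const]
  have hint : IntervalIntegrable (fun t => N.excess (z t) (f t) v d) volume 0 T :=
    (hin.add hsrc).sub hout
  have heq : N.excess (T⁻¹ * ∫ t in (0 : ℝ)..T, z t) (N.averageFlow f T) v d
      = T⁻¹ * ∫ t in (0 : ℝ)..T, N.excess (z t) (f t) v d := by
    simp only [excess, averageFlow]
    rw [intervalIntegral.integral_sub (hin.add hsrc) hout, intervalIntegral.integral_add hin hsrc,
      intervalIntegral.integral_finsetSum fun u _ => h.intervalIntegrable_flow d u v hT.le,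
      intervalIntegral.integral_finsetSum fun u _ => h.intervalIntegrable_flow d v u hT.le,
      ← Finset.mul_sum, ← Finset.mul_sum]
    split_ifs
    · ring
    · simp
      ring
  rw [heq]
  refine mul_le_mul_of_nonneg_left ?_ (inv_pos.2 hT).le
  -- The projection only raises the queue derivative, so integrating it bounds the accumulated
  -- excess by the queue growth.
  rw [le_inv_mul_iff₀ (hk v d), ← (h.ac_multiplier v d T hT).integral_deriv_eq_sub,
    ← intervalIntegral.integral_const_mul]
  refine intervalIntegral.integral_mono_ae_restrict hT.le (hint.const_mul _)
    (h.ac_multiplier v d T hT).intervalIntegrable_deriv ?_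
  rw [← Measure.restrict_congr_set Ioc_ae_eq_Icc]
  filter_upwards [ae_restrict_of_ae_restrict_of_subset Set.Ioc_subset_Ioi_self h.multiplier_ode]
    with t ht
  rw [(ht v d hv).deriv]
  exact mul_le_mul_of_nonneg_left (le_posProj _ _) (hk v d).le

/-- The rate together with the time-averaged schedule approaches the set of optimal solutions. -/
theorem tendsto_infDist_optimalSet (h : N.IsTrajectory U α k z lam f g) (hk : ∀ v d, 0 < k v d)
    {x : ℝ × N.Flows × N.Rates} (hx : x ∈ N.optimalSet U) (hz : Tendsto z atTop (𝓝 x.1))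
    {lamopt : N.Multipliers} (hlam : Tendsto lam atTop (𝓝 lamopt)) :
    Tendsto (fun T => Metric.infDist (z T, N.averageFlow f T, N.averageRate g T)
      (N.optimalSet U)) atTop (𝓝 0) := by
  rw [tendsto_iff_ultrafilter]
  intro 𝒰 h𝒰
  have hmem : ∀ᶠ T in atTop, (N.averageFlow f T, N.averageRate g T) ∈ N.scheduleSet := by
    filter_upwards [eventually_gt_atTop 0] with T hT using h.average_mem_scheduleSet hT
  obtain ⟨p, hp, htp⟩ := N.isCompact_scheduleSet.ultrafilter_le_nhds'
    (𝒰.map fun T => (N.averageFlow f T, N.averageRate g T)) (h𝒰 hmem)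
  have htp : Tendsto (fun T => (N.averageFlow f T, N.averageRate g T)) 𝒰 (𝓝 p) := htp
  -- Conservation for averages involves the average of `z`, while the claim concerns `z` itself;
  -- both have the same limit.
  have hzavg : Tendsto (fun T : ℝ => T⁻¹ * ∫ t in (0 : ℝ)..T, z t) atTop (𝓝 x.1) :=
    tendsto_inv_mul_integral_of_tendsto
      (fun a b ha hb => h.intervalIntegrable_broadcast ha hb) hz
  have hfeas : N.Feasible (x.1, p) := by
    refine ⟨hx.1.broadcast_nonneg, hp, fun d v hv => ?_⟩
    have h1 : Tendsto (fun T : ℝ => N.excess (T⁻¹ * ∫ t in (0 : ℝ)..T, z t)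
        (N.averageFlow f T) v d) 𝒰 (𝓝 (N.excess x.1 p.1 v d)) := by
      have hflow : Tendsto (fun T => N.averageFlow f T) 𝒰 (𝓝 p.1) :=
        (continuous_fst.tendsto p).comp htp
      have hpair := (hzavg.mono_left h𝒰).prodMk_nhds hflow
      have hexc := ((N.continuous_excess v d).tendsto (x.1, p.1)).comp hpair
      simpa only [Function.comp_def] using hexc
    have h2 : Tendsto (fun T : ℝ => T⁻¹ * ((k v d)⁻¹ * (lam T v d - lam 0 v d))) atTop (𝓝 0) := by
      have h3 := tendsto_pi_nhds.1 (tendsto_pi_nhds.1 hlam v) d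
      have h4 := (tendsto_inv_atTop_zero (𝕜 := ℝ)).mul
        ((h3.sub_const (lam 0 v d)).const_mul (k v d)⁻¹)
      rwa [zero_mul] at h4
    refine le_of_tendsto_of_tendsto h1 (h2.mono_left h𝒰) (h𝒰 ?_)
    filter_upwards [eventually_gt_atTop 0] with T hT using h.excess_average_le hk hT hv
  have hopt : (x.1, p) ∈ N.optimalSet U := mem_optimalSet_of_rate_eq hx hfeas rfl
  have h1 : Tendsto (fun T => (z T, N.averageFlow f T, N.averageRate g T)) 𝒰 (𝓝 (x.1, p)) :=
    (hz.mono_left h𝒰).prodMk_nhds htp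
  have h2 := ((Metric.continuous_infDist_pt (N.optimalSet U)).tendsto (x.1, p)).comp h1
  rwa [Metric.infDist_zero_of_mem hopt] at h2

end IsTrajectory

end OverlayNetwork

theorem theorem1 {V : Type*} [Fintype V] [Nontrivial V] (N : OverlayNetwork V)
    (U : ℝ → ℝ) (hU : StrictConcaveOn ℝ (Set.Ici 0) U)
    (hU1 : DifferentiableOn ℝ U (Set.Ici 0))
    (hU2 : DifferentiableOn ℝ (derivWithin U (Set.Ici 0)) (Set.Ici 0))
    (α : ℝ) (hα : 0 < α) (k : V → N.Receiver → ℝ) (hk : ∀ v d, 0 < k v d) :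
    (N.optimalSet U).Nonempty ∧
    ∃ zopt : ℝ, (∀ x ∈ N.optimalSet U, x.1 = zopt) ∧
      ∀ (z : ℝ → ℝ) (lam : ℝ → N.Multipliers) (f : ℝ → N.Flows) (g : ℝ → N.Rates),
        N.IsTrajectory U α k z lam f g →
          Tendsto z atTop (𝓝 zopt) ∧
          (∃ lamopt : N.Multipliers, Tendsto lam atTop (𝓝 lamopt) ∧
            ∀ x ∈ N.optimalSet U, N.IsSaddlePoint U x lamopt) ∧
          Tendsto
            (fun T => Metric.infDist (z T, N.averageFlow f T, N.averageRate g T)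
              (N.optimalSet U))
            atTop (𝓝 0) := by
  have hU' : ContinuousOn (derivWithin U (Set.Ici 0)) (Set.Ici 0) := hU2.continuousOn
  obtain ⟨x, hx⟩ := N.optimalSet_nonempty hU1.continuousOn
  refine ⟨⟨x, hx⟩, x.1, fun y hy => OverlayNetwork.optimalSet_rate_unique hU hy hx,
    fun z lam f g h => ?_⟩
  obtain ⟨hz, lamopt, hopt, hlam⟩ := h.tendsto_state hα hk hU hU1 hU' hx
  refine ⟨hz, ⟨lamopt, hlam, fun y hy => ?_⟩, h.tendsto_infDist_optimalSet hk hx hz hlam⟩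
  -- Dual optimality depends on the optimal solution only through its rate, so one multiplier serves
  -- all of them.
  rw [OverlayNetwork.optimalSet_rate_unique hU hx hy] at hopt
  exact hopt.isSaddlePoint hy
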